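/- **Definitions.** Let $\mathfrak A$ be a unital C*-algebra with $1\neq 0$, self-adjoint part $\mathfrak{sa}(\mathfrak A)$ and state space $\mathscr S(\mathfrak A)$. A seminorm $\mathsf L$ on a dense subspace $\mathrm{dom}\,\mathsf L$ of $\mathfrak{sa}(\mathfrak A)$ (set to $\infty$ elsewhere) with $\{\mathsf L=0\}=\mathbb R1$ is a *Lip-norm* if $\mathsf{mk}_{\mathsf L}(\varphi,\psi)=\sup\{|\varphi(a)-\psi(a)|:a\in\mathfrak{sa}(\mathfrak A),\ \mathsf L(a)\le 1\}$ is a (finite) metric inducing the weak* topology of $\mathscr S(\mathfrak A)$. The pair $(\mathfrak A,\mathsf L)$ is a *Leibniz quantum compact metric space* if moreover $\mathsf L$ is lower semicontinuous and $\mathsf L(\tfrac{ab+ba}2)$ and $\mathsf L(\tfrac{ab-ba}{2i})$ are at most $\|a\|\mathsf L(b)+\|b\|\mathsf L(a)$; it is a *compact C*-metric space* (class $\mathcal{CM}$) if, in addition, $\mathsf L$ is the restriction to $\mathfrak{sa}(\mathfrak A)$ of a seminorm $\mathsf L$ defined on a dense *-subalgebra of $\mathfrak A$ that is closed under inverses,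 with $\mathsf L(ab)\le\|a\|\mathsf L(b)+\mathsf L(a)\|b\|$ and $\mathsf L(a^{-1})\le\|a^{-1}\|^2\mathsf L(a)$. Write $\mathrm{Haus}$ for the Hausdorff distance and $\pi^*$ for the dual map of $\pi$ on states. *Tunnels.* A tunnel $\tau=(\mathfrak D,\mathsf L_{\mathfrak D},\pi_{\mathfrak A},\pi_{\mathfrak B})$ from $(\mathfrak A,\mathsf L_{\mathfrak A})$ to $(\mathfrak B,\mathsf L_{\mathfrak B})$ is a Leibniz quantum compact metric space $(\mathfrak D,\mathsf L_{\mathfrak D})$ with unital *-epimorphisms of $\mathfrak D$ onto $\mathfrak A$ and $\mathfrak B$ along which the quotients of $\mathsf L_{\mathfrak D}$ on the self-adjoint parts are $\mathsf L_{\mathfrak A}$ and $\mathsf L_{\mathfrak B}$. Its length is the maximum of its reach $\mathrm{Haus}_{\mathsf{mk}_{\mathsf L_{\mathfrak D}}}(\pi_{\mathfrak A}^*\mathscr S(\mathfrak A),\pi_{\mathfrak B}^*\mathscr S(\mathfrak B))$ and its depth $\mathrm{Haus}_{\mathsf{mk}_{\mathsf L_{\mathfrak D}}}(\mathscr S(\mathfrak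 D),\overline{\mathrm{co}}(\pi_{\mathfrak A}^*\mathscr S(\mathfrak A)\cup\pi_{\mathfrak B}^*\mathscr S(\mathfrak B)))$. For a nonempty class $\mathcal C$ of Leibniz quantum compact metric spaces, a class $\mathcal T$ of tunnels is $\mathcal C$-*compatible* if its tunnels go between members of $\mathcal C$, it is closed under reversal (exchanging the two epimorphisms), any two members of $\mathcal C$ are joined by a finite path of tunnels in $\mathcal T$ through members of $\mathcal C$ (a $\mathcal T$-*journey*), and for every *-isomorphism $h:\mathfrak A\to\mathfrak B$ between members of $\mathcal C$ with $\mathsf L_{\mathfrak B}\circ h=\mathsf L_{\mathfrak A}$ it contains $(\mathfrak A,\mathsf L_{\mathfrak A},\mathrm{id},h)$ and $(\mathfrak B,\mathsf L_{\mathfrak B},\mathrm{id},h^{-1})$. The dual propinquity $\Lambda^*_{\mathcal T}$ is the infimum of the lengths (sums of tunnel lengths) of the $\mathcal T$-journeys between two members of $\mathcal C$. $\Lambda^*$ is the case of all tunnels between all Leibniz quantum compact metric spaces; $\Lambda^*_{\mathcal{CM}}$ is the case of $\mathcal C=\mathcal{CM}$ and all tunnels between members of $\mathcal{CM}$ with $(\mathfrak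 D,\mathsf L_{\mathfrak D})\in\mathcal{CM}$. *Bridges.* A bridge $\gamma=(\mathfrak D,\omega,\pi_{\mathfrak A},\pi_{\mathfrak B})$ is a unital C*-algebra $\mathfrak D$ with unital *-monomorphisms $\pi_{\mathfrak A}:\mathfrak A\to\mathfrak D$, $\pi_{\mathfrak B}:\mathfrak B\to\mathfrak D$ and $\omega\in\mathfrak D$ such that $\mathscr S_1(\omega)=\{\varphi\in\mathscr S(\mathfrak D):\varphi((1-\omega)^*(1-\omega))=\varphi((1-\omega)(1-\omega)^*)=0\}$ is not empty. Put $\mathrm{bn}_\gamma(a,b)=\|\pi_{\mathfrak A}(a)\omega-\omega\pi_{\mathfrak B}(b)\|$. The length of $\gamma$ is the maximum of $\mathrm{Haus}_{\|\cdot\|}(\{\pi_{\mathfrak A}(a)\omega:\mathsf L_{\mathfrak A}(a)\le1\},\{\omega\pi_{\mathfrak B}(b):\mathsf L_{\mathfrak B}(b)\le1\})$ ($a,b$ self-adjoint), $\mathrm{Haus}_{\mathsf{mk}_{\mathsf L_{\mathfrak A}}}(\mathscr S(\mathfrak A),\pi_{\mathfrak A}^*\mathscr S_1(\omega))$ and $\mathrm{Haus}_{\mathsf{mk}_{\mathsf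 L_{\mathfrak B}}}(\mathscr S(\mathfrak B),\pi_{\mathfrak B}^*\mathscr S_1(\omega))$. The quantum propinquity $\Lambda_{\mathcal C}$ is the infimum of the sums of bridge lengths over finite paths of bridges through members of $\mathcal C$; $\Lambda$ is the case where $\mathcal C$ consists of all Leibniz quantum compact metric spaces. *Rieffel's distances.* $\mathrm{dist}_q((\mathfrak A,\mathsf L_{\mathfrak A}),(\mathfrak B,\mathsf L_{\mathfrak B}))$ is the infimum of $\mathrm{Haus}_{\mathsf{mk}_{\mathsf L}}(\mathscr S(\mathfrak A),\mathscr S(\mathfrak B))$ over all Lip-norms $\mathsf L$ on $\mathfrak A\oplus\mathfrak B$, with domain $\mathrm{dom}\,\mathsf L_{\mathfrak A}\oplus\mathrm{dom}\,\mathsf L_{\mathfrak B}$, whose quotients are $\mathsf L_{\mathfrak A}$ and $\mathsf L_{\mathfrak B}$. $\mathrm{prox}$ is the same infimum over the Lip-norms $\mathsf L$ with these quotients (no condition on the domain) for which $(\mathfrak A\oplus\mathfrak B,\mathsf L)\in\mathcal{CM}$. **Theorem.** Let $X=(\mathfrak A,\mathsf L_{\mathfrak A})$ and $Y=(\mathfrak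 B,\mathsf L_{\mathfrak B})$ be Leibniz quantum compact metric spaces. 1. $\mathrm{dist}_q(X,Y)\le\Lambda^*(X,Y)\le 2\Lambda(X,Y)$. 2. If $X,Y$ belong to a class $\mathcal C$ of Leibniz quantum compact metric spaces and $\mathcal T\subseteq\mathcal G$ are $\mathcal C$-compatible classes of tunnels, then $\Lambda^*_{\mathcal G}(X,Y)\le\Lambda^*_{\mathcal T}(X,Y)$. If moreover $\mathcal T$ contains every tunnel of the form $(\mathfrak A'\oplus\mathfrak B',\max\{\mathsf L_{\mathfrak A'},\mathsf L_{\mathfrak B'},\tfrac1r\mathrm{bn}_\gamma\},\mathrm{pr}_1,\mathrm{pr}_2)$, where $\gamma$ is a bridge between members $(\mathfrak A',\mathsf L_{\mathfrak A'})$, $(\mathfrak B',\mathsf L_{\mathfrak B'})$ of $\mathcal C$ and the real number $r$ is larger than the length of $\gamma$, then $\Lambda^*_{\mathcal T}(X,Y)\le 2\Lambda_{\mathcal C}(X,Y)$. 3. If $X$ and $Y$ are compact C*-metric spaces, then $\Lambda^*(X,Y)\le\Lambda^*_{\mathcal{CM}}(X,Y)\le\mathrm{prox}(X,Y)$. -/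

import Mathlib

open scoped ENNReal NNReal ComplexOrder CStarAlgebra

universe u

noncomputable section

namespace Propinquity

/-! ## States of a unital C*-algebra -/

/-- The states of a unital C*-algebra: the positive continuous linear functionals that take the
value `1` at the unit. -/
structure StateSpace (A : Type u) [CStarAlgebra A] : Type u where
  toDual : WeakDual ℂ A
  nonneg : ∀ a : A, 0 ≤ toDual (star a * a)
  map_one : toDual 1 = 1

instance (A : Type u) [CStarAlgebra A] : CoeFun (StateSpace A) fun _ => A → ℂ :=
  ⟨fun φ => φ.toDual⟩

/-- The state space carries the weak* topology. -/
instance (A : Type u) [CStarAlgebra A] : TopologicalSpace (StateSpace A) :=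
  TopologicalSpace.induced StateSpace.toDual inferInstance

/-- The dual map `φ ↦ φ ∘ π` from states of `B` to states of `A` of a unital *-morphism
`π : A → B`. -/
def StateSpace.comap {A B : Type u} [CStarAlgebra A] [CStarAlgebra B] (π : A →⋆ₐ[ℂ] B)
    (φ : StateSpace B) : StateSpace A where
  toDual := StrongDual.toWeakDual ((WeakDual.toStrongDual φ.toDual).comp
    (⟨π.toAlgHom.toLinearMap, map_continuous π⟩ : A →L[ℂ] B))
  nonneg a := by
    have h := φ.nonneg (π a)
    rw [← map_star, ← map_mul] at h
    exact h
  map_one := by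
    have h := φ.map_one
    rw [← _root_.map_one π] at h
    exact h

/-- The map between self-adjoint parts induced by a *-morphism. -/
def saMap {A B : Type u} [CStarAlgebra A] [CStarAlgebra B] (π : A →⋆ₐ[ℂ] B)
    (a : selfAdjoint A) : selfAdjoint B :=
  ⟨π a, a.2.map π⟩

/-! ## Lip-norms

A seminorm that is defined on a subspace of the self-adjoint part `selfAdjoint A` is extended by
the value `∞` outside its domain; its domain is then `{a | L a < ∞}`. -/

/-- The Monge-Kantorovich extended metric
`mk L φ ψ = sup {|φ a - ψ a| : a self-adjoint, L a ≤ 1}`. -/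
def mk {A : Type u} [CStarAlgebra A] (L : selfAdjoint A → ℝ≥0∞) (φ ψ : StateSpace A) : ℝ≥0∞ :=
  ⨆ (a : selfAdjoint A) (_ : L a ≤ 1), ‖φ (a : A) - ψ (a : A)‖ₑ

/-- The state space with the Monge-Kantorovich extended (pseudo)metric. This is not an instance:
the default topology of `StateSpace A` is the weak* topology. -/
abbrev mkEMetric {A : Type u} [CStarAlgebra A] (L : selfAdjoint A → ℝ≥0∞) :
    PseudoEMetricSpace (StateSpace A) where
  edist := mk L
  edist_self φ := by simp [mk]
  edist_comm φ ψ := by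
    simp only [mk]
    refine iSup_congr fun a => iSup_congr fun _ => ?_
    rw [← enorm_neg, neg_sub]
  edist_triangle φ ψ χ := by
    simp only [mk]
    refine iSup₂_le fun a ha => ?_
    calc ‖φ (a : A) - χ (a : A)‖ₑ
        = ‖(φ (a : A) - ψ (a : A)) + (ψ (a : A) - χ (a : A))‖ₑ := by
          rw [sub_add_sub_cancel]
      _ ≤ ‖φ (a : A) - ψ (a : A)‖ₑ + ‖ψ (a : A) - χ (a : A)‖ₑ := enorm_add_le _ _
      _ ≤ _ := add_le_add
          (le_iSup₂ (f := fun (b : selfAdjoint A) (_ : L b ≤ 1) =>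
            ‖φ (b : A) - ψ (b : A)‖ₑ) a ha)
          (le_iSup₂ (f := fun (b : selfAdjoint A) (_ : L b ≤ 1) =>
            ‖ψ (b : A) - χ (b : A)‖ₑ) a ha)

/-- The Hausdorff distance between sets of states for the Monge-Kantorovich metric. -/
def mkHausdorff {A : Type u} [CStarAlgebra A] (L : selfAdjoint A → ℝ≥0∞)
    (S T : Set (StateSpace A)) : ℝ≥0∞ :=
  @Metric.hausdorffEDist (StateSpace A) (mkEMetric L) S T

/-- `L` is a Lip-norm on `A`: a seminorm defined on a norm-dense subspace of the self-adjoint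
part, null exactly on the real multiples of the unit, whose Monge-Kantorovich metric is finite
and induces the weak* topology on the state space. -/
structure IsLipNorm {A : Type u} [CStarAlgebra A] (L : selfAdjoint A → ℝ≥0∞) : Prop where
  add_le : ∀ a b, L (a + b) ≤ L a + L b
  smul : ∀ (r : ℝ) a, L (r • a) = ‖r‖ₑ * L a
  dense_dom : Dense {a | L a < ∞}
  eq_zero_iff : ∀ a, L a = 0 ↔ ∃ r : ℝ, a = r • (1 : selfAdjoint A)
  mk_ne_top : ∀ φ ψ : StateSpace A, mk L φ ψ ≠ ∞
  topology_eq : (mkEMetric L).toUniformSpace.toTopologicalSpace =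
    (inferInstance : TopologicalSpace (StateSpace A))

/-- The Jordan product `(ab + ba) / 2`. -/
def jordan {A : Type u} [CStarAlgebra A] (a b : selfAdjoint A) : selfAdjoint A :=
  ⟨(1 / 2 : ℂ) • ((a : A) * b + b * a), by
    rw [selfAdjoint.mem_iff, star_smul, star_add, star_mul, star_mul, a.2.star_eq, b.2.star_eq,
      add_comm]
    congr 1
    simp⟩

/-- The Lie product `(ab - ba) / (2i)`. -/
def lie {A : Type u} [CStarAlgebra A] (a b : selfAdjoint A) : selfAdjoint A :=
  ⟨(1 / (2 * Complex.I) : ℂ) • ((a : A) * b - b * a), by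
    rw [selfAdjoint.mem_iff, star_smul, star_sub, star_mul, star_mul, a.2.star_eq, b.2.star_eq,
      ← neg_sub, smul_neg, ← neg_smul]
    congr 1
    simp⟩

/-- `L` is a lower semicontinuous Leibniz Lip-norm. (That the domain is closed under the Jordan
and the Lie product is part of the two inequalities.) -/
structure IsLeibnizLipNorm {A : Type u} [CStarAlgebra A] (L : selfAdjoint A → ℝ≥0∞) : Prop
    extends IsLipNorm L where
  jordan_le : ∀ a b, L (jordan a b) ≤ ‖(a : A)‖ₑ * L b + ‖(b : A)‖ₑ * L a
  lie_le : ∀ a b, L (lie a b) ≤ ‖(a : A)‖ₑ * L b + ‖(b : A)‖ₑ * L a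
  lowerSemicontinuous : LowerSemicontinuous L

/-- A Leibniz quantum compact metric space. -/
structure LQCMS : Type (u + 1) where
  carrier : Type u
  [cstar : CStarAlgebra carrier]
  [nontrivial : Nontrivial carrier]
  L : selfAdjoint carrier → ℝ≥0∞
  isLeibnizLipNorm : IsLeibnizLipNorm L

instance : CoeSort LQCMS.{u} (Type u) := ⟨LQCMS.carrier⟩

attribute [instance] LQCMS.cstar LQCMS.nontrivial

/-- `M`, defined on the whole algebra (with value `∞` outside its domain), is a strongly Leibniz
seminorm with a dense *-subalgebra as its domain, closed under the inverse. -/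
structure IsStronglyLeibniz {A : Type u} [CStarAlgebra A] (M : A → ℝ≥0∞) : Prop where
  add_le : ∀ a b, M (a + b) ≤ M a + M b
  smul : ∀ (z : ℂ) a, M (z • a) = ‖z‖ₑ * M a
  dense_dom : Dense {a | M a < ∞}
  star_dom : ∀ a, M a < ∞ → M (star a) < ∞
  mul_le : ∀ a b, M (a * b) ≤ ‖a‖ₑ * M b + M a * ‖b‖ₑ
  inv_le : ∀ a : Aˣ, M (a : A) < ∞ → M ((a⁻¹ : Aˣ) : A) ≤ ‖((a⁻¹ : Aˣ) : A)‖ₑ ^ 2 * M (a : A)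

/-- `L` is the restriction to the self-adjoint part of a strongly Leibniz seminorm. -/
def HasStronglyLeibnizExtension {A : Type u} [CStarAlgebra A] (L : selfAdjoint A → ℝ≥0∞) : Prop :=
  ∃ M : A → ℝ≥0∞, IsStronglyLeibniz M ∧ ∀ a : selfAdjoint A, M (a : A) = L a

/-- The class `CM` of compact C*-metric spaces. -/
def CM : Set LQCMS.{u} := {X | HasStronglyLeibnizExtension X.L}

/-! ## Tunnels and the dual propinquity -/

/-- `L` is the quotient of `LD` along `π`. -/
def IsQuotient {D A : Type u} [CStarAlgebra D] [CStarAlgebra A] (π : D →⋆ₐ[ℂ] A)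
    (LD : selfAdjoint D → ℝ≥0∞) (L : selfAdjoint A → ℝ≥0∞) : Prop :=
  ∀ a, L a = ⨅ (d : selfAdjoint D) (_ : saMap π d = a), LD d

/-- A tunnel `(D, L_D, left, right)` from `X` to `Y`. -/
structure Tunnel (X Y : LQCMS.{u}) : Type (u + 1) where
  D : LQCMS.{u}
  left : D →⋆ₐ[ℂ] X
  right : D →⋆ₐ[ℂ] Y
  left_surjective : Function.Surjective left
  right_surjective : Function.Surjective right
  left_quotient : IsQuotient left D.L X.L
  right_quotient : IsQuotient right D.L Y.L

namespace Tunnel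

variable {X Y : LQCMS.{u}}

/-- The reach: the Hausdorff distance between the copies of the two state spaces in the state
space of `D`. -/
def reach (τ : Tunnel X Y) : ℝ≥0∞ :=
  mkHausdorff τ.D.L (Set.range (StateSpace.comap τ.left)) (Set.range (StateSpace.comap τ.right))

/-- The depth: the Hausdorff distance between the state space of `D` and the weak*-closed convex
hull of the union of the copies of the two state spaces. -/
def depth (τ : Tunnel X Y) : ℝ≥0∞ :=
  mkHausdorff τ.D.L Set.univ
    {φ : StateSpace τ.D | φ.toDual ∈ closedConvexHull ℝ (StateSpace.toDual ''
      (Set.range (StateSpace.comap τ.left) ∪ Set.range (StateSpace.comap τ.right)))}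

/-- The length of a tunnel. -/
def length (τ : Tunnel X Y) : ℝ≥0∞ := max τ.reach τ.depth

/-- The reversed tunnel. -/
def reverse (τ : Tunnel X Y) : Tunnel Y X :=
  ⟨τ.D, τ.right, τ.left, τ.right_surjective, τ.left_surjective, τ.right_quotient,
    τ.left_quotient⟩

/-- The tunnel `(X, L_X, id, h)` of a *-isomorphism `h` with `L_Y ∘ h = L_X`. -/
def ofIso (h : X ≃⋆ₐ[ℂ] Y) (hL : ∀ a, Y.L (saMap (h : X →⋆ₐ[ℂ] Y) a) = X.L a) :
    Tunnel X Y where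
  D := X
  left := StarAlgHom.id ℂ X
  right := h
  left_surjective := Function.surjective_id
  right_surjective := h.surjective
  left_quotient a := by
    refine le_antisymm (le_iInf₂ fun d hd => ?_) (iInf₂_le (f := fun (d : selfAdjoint X)
      (_ : saMap (StarAlgHom.id ℂ X) d = a) => X.L d) a rfl)
    rw [← hd]
    exact le_of_eq rfl
  right_quotient b := by
    refine le_antisymm (le_iInf₂ fun d hd => by rw [← hd, hL]) ?_
    have hb : saMap (h : X →⋆ₐ[ℂ] Y) (saMap (h.symm : Y →⋆ₐ[ℂ] X) b) = b :=
      Subtype.ext (h.apply_symm_apply (b : Y))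
    refine (iInf₂_le (f := fun (d : selfAdjoint X)
      (_ : saMap (h : X →⋆ₐ[ℂ] Y) d = b) => X.L d) _ hb).trans (le_of_eq ?_)
    rw [← hL, hb]

/-- The tunnel `(A ⊕ B, L, pr₁, pr₂)` of a Leibniz Lip-norm `L` on `A ⊕ B` with the right
quotients. -/
def ofSum (L : selfAdjoint (X × Y) → ℝ≥0∞) (hL : IsLeibnizLipNorm L)
    (h₁ : IsQuotient (StarAlgHom.fst ℂ X Y) L X.L)
    (h₂ : IsQuotient (StarAlgHom.snd ℂ X Y) L Y.L) : Tunnel X Y where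
  D := ⟨X × Y, L, hL⟩
  left := StarAlgHom.fst ℂ X Y
  right := StarAlgHom.snd ℂ X Y
  left_surjective := Prod.fst_surjective
  right_surjective := Prod.snd_surjective
  left_quotient := h₁
  right_quotient := h₂

end Tunnel

/-- A class of tunnels. -/
abbrev TunnelClass := ∀ X Y : LQCMS.{u}, Set (Tunnel X Y)

/-- A `T`-journey from `X` to `Y`: a finite nonempty path of tunnels in `T` through members
of `C`. -/
inductive Journey (C : Set LQCMS.{u}) (T : TunnelClass.{u}) : LQCMS.{u} → LQCMS.{u} → Type (u + 1)
  | single {X Y : LQCMS.{u}} (hX : X ∈ C) (hY : Y ∈ C) (τ : Tunnel X Y) (hτ : τ ∈ T X Y) :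
      Journey C T X Y
  | cons {X Y Z : LQCMS.{u}} (hX : X ∈ C) (τ : Tunnel X Y) (hτ : τ ∈ T X Y)
      (J : Journey C T Y Z) : Journey C T X Z

/-- The length of a journey is the sum of the lengths of its tunnels. -/
def Journey.length {C : Set LQCMS.{u}} {T : TunnelClass.{u}} {X Y : LQCMS.{u}} :
    Journey C T X Y → ℝ≥0∞
  | .single _ _ τ _ => τ.length
  | .cons _ τ _ J => τ.length + J.length

/-- The class `T` of tunnels is compatible with the class `C`. -/
structure IsCompatible (C : Set LQCMS.{u}) (T : TunnelClass.{u}) : Prop where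
  nonempty : C.Nonempty
  reverse_mem : ∀ {X Y : LQCMS.{u}} (τ : Tunnel X Y), τ ∈ T X Y → τ.reverse ∈ T Y X
  connected : ∀ X ∈ C, ∀ Y ∈ C, Nonempty (Journey C T X Y)
  iso_mem : ∀ X ∈ C, ∀ Y ∈ C, ∀ (h : X ≃⋆ₐ[ℂ] Y)
    (hL : ∀ a, Y.L (saMap (h : X →⋆ₐ[ℂ] Y) a) = X.L a)
    (hL' : ∀ b, X.L (saMap (h.symm : Y →⋆ₐ[ℂ] X) b) = Y.L b),
    Tunnel.ofIso h hL ∈ T X Y ∧ Tunnel.ofIso h.symm hL' ∈ T Y X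
  mem_class : ∀ {X Y : LQCMS.{u}} (τ : Tunnel X Y), τ ∈ T X Y → X ∈ C ∧ Y ∈ C

/-- The dual Gromov-Hausdorff `T`-propinquity on the class `C`. -/
def dualPropinquityOn (C : Set LQCMS.{u}) (T : TunnelClass.{u}) (X Y : LQCMS.{u}) : ℝ≥0∞ :=
  ⨅ J : Journey C T X Y, J.length

/-- The class of all tunnels. -/
def allTunnels : TunnelClass.{u} := fun _ _ => Set.univ

/-- The class of the tunnels `(D, L_D, π, ρ)` between members of `CM` such that `(D, L_D)` is in
`CM`. -/
def cmTunnels : TunnelClass.{u} := fun X Y => {τ | X ∈ CM ∧ Y ∈ CM ∧ τ.D ∈ CM}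

/-- The dual propinquity `Λ*`. -/
def dualPropinquity (X Y : LQCMS.{u}) : ℝ≥0∞ := dualPropinquityOn Set.univ allTunnels X Y

/-- The dual propinquity specialized to compact C*-metric spaces. -/
def dualPropinquityCM (X Y : LQCMS.{u}) : ℝ≥0∞ := dualPropinquityOn CM cmTunnels X Y

/-! ## The quantum Gromov-Hausdorff distance and the quantum proximity -/

/-- `L` is an admissible Lip-norm on `A ⊕ B`: its quotients are `L_A` and `L_B`. -/
structure IsAdmissible (X Y : LQCMS.{u}) (L : selfAdjoint (X × Y) → ℝ≥0∞) : Prop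
    extends IsLipNorm L where
  quotient_fst : IsQuotient (StarAlgHom.fst ℂ X Y) L X.L
  quotient_snd : IsQuotient (StarAlgHom.snd ℂ X Y) L Y.L

/-- The Hausdorff distance between the copies of the state spaces of `A` and `B` in the state
space of `A ⊕ B`. -/
def sumHausdorff (X Y : LQCMS.{u}) (L : selfAdjoint (X × Y) → ℝ≥0∞) : ℝ≥0∞ :=
  mkHausdorff L (Set.range (StateSpace.comap (StarAlgHom.fst ℂ X Y)))
    (Set.range (StateSpace.comap (StarAlgHom.snd ℂ X Y)))

/-- Rieffel's quantum Gromov-Hausdorff distance. There, `(A, L_A)` stands for the order-unit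
space `dom L_A` with its finite seminorm `L_A`, so that admissible Lip-norms are finite on all of
`dom L_A ⊕ dom L_B`. -/
def distQ (X Y : LQCMS.{u}) : ℝ≥0∞ :=
  ⨅ (L : selfAdjoint (X × Y) → ℝ≥0∞) (_ : IsAdmissible X Y L)
    (_ : ∀ c, X.L (saMap (StarAlgHom.fst ℂ X Y) c) < ∞ →
      Y.L (saMap (StarAlgHom.snd ℂ X Y) c) < ∞ → L c < ∞),
    sumHausdorff X Y L

/-- Rieffel's quantum proximity: the infimum over the admissible Lip-norms that make `A ⊕ B` a
compact C*-metric space. -/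
def prox (X Y : LQCMS.{u}) : ℝ≥0∞ :=
  ⨅ (L : selfAdjoint (X × Y) → ℝ≥0∞) (_ : IsAdmissible X Y L) (_ : IsLeibnizLipNorm L)
    (_ : HasStronglyLeibnizExtension L), sumHausdorff X Y L

/-! ## Bridges and the quantum propinquity -/

/-- The 1-level set of `ω`. -/
def levelSet {D : Type u} [CStarAlgebra D] (ω : D) : Set (StateSpace D) :=
  {φ | φ (star (1 - ω) * (1 - ω)) = 0 ∧ φ ((1 - ω) * star (1 - ω)) = 0}

/-- A bridge `(D, ω, left, right)` between the algebras of `X` and `Y`. -/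
structure Bridge (X Y : LQCMS.{u}) : Type (u + 1) where
  D : Type u
  [cstar : CStarAlgebra D]
  pivot : D
  left : X →⋆ₐ[ℂ] D
  right : Y →⋆ₐ[ℂ] D
  left_injective : Function.Injective left
  right_injective : Function.Injective right
  levelSet_nonempty : (levelSet pivot).Nonempty

attribute [instance] Bridge.cstar

namespace Bridge

variable {X Y : LQCMS.{u}}

/-- The bridge seminorm `‖π_A(a) ω - ω π_B(b)‖`. -/
def seminorm (γ : Bridge X Y) (a : X) (b : Y) : ℝ≥0∞ :=
  ‖γ.left a * γ.pivot - γ.pivot * γ.right b‖ₑ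

/-- The reach: the Hausdorff distance in `D` between the Lipschitz balls times the pivot. -/
def reach (γ : Bridge X Y) : ℝ≥0∞ :=
  Metric.hausdorffEDist
    {d : γ.D | ∃ a : selfAdjoint X, X.L a ≤ 1 ∧ d = γ.left (a : X) * γ.pivot}
    {d : γ.D | ∃ b : selfAdjoint Y, Y.L b ≤ 1 ∧ d = γ.pivot * γ.right (b : Y)}

/-- The height: how far the restrictions of the states in the 1-level set are from filling the
two state spaces. -/
def height (γ : Bridge X Y) : ℝ≥0∞ :=
  max (mkHausdorff X.L Set.univ (StateSpace.comap γ.left '' levelSet γ.pivot))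
    (mkHausdorff Y.L Set.univ (StateSpace.comap γ.right '' levelSet γ.pivot))

/-- The length of a bridge. -/
def length (γ : Bridge X Y) : ℝ≥0∞ := max γ.reach γ.height

/-- The seminorm `max {L_A(a), L_B(b), ‖π_A(a) ω - ω π_B(b)‖ / r}` on `A ⊕ B`. -/
def sumNorm (γ : Bridge X Y) (r : ℝ≥0) (c : selfAdjoint (X × Y)) : ℝ≥0∞ :=
  max (max (X.L (saMap (StarAlgHom.fst ℂ X Y) c)) (Y.L (saMap (StarAlgHom.snd ℂ X Y) c)))
    (γ.seminorm (c : X × Y).1 (c : X × Y).2 / r)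

end Bridge

/-- A `C`-trek from `X` to `Y`: a finite nonempty path of bridges through members of `C`. -/
inductive Trek (C : Set LQCMS.{u}) : LQCMS.{u} → LQCMS.{u} → Type (u + 1)
  | single {X Y : LQCMS.{u}} (hX : X ∈ C) (hY : Y ∈ C) (γ : Bridge X Y) : Trek C X Y
  | cons {X Y Z : LQCMS.{u}} (hX : X ∈ C) (γ : Bridge X Y) (Γ : Trek C Y Z) : Trek C X Z

/-- The length of a trek is the sum of the lengths of its bridges. -/
def Trek.length {C : Set LQCMS.{u}} {X Y : LQCMS.{u}} : Trek C X Y → ℝ≥0∞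
  | .single _ _ γ => γ.length
  | .cons _ γ Γ => γ.length + Γ.length

/-- The quantum Gromov-Hausdorff propinquity `Λ_C` on the class `C`. -/
def quantumPropinquityOn (C : Set LQCMS.{u}) (X Y : LQCMS.{u}) : ℝ≥0∞ :=
  ⨅ Γ : Trek C X Y, Γ.length

/-- The quantum Gromov-Hausdorff propinquity `Λ`. -/
def quantumPropinquity (X Y : LQCMS.{u}) : ℝ≥0∞ := quantumPropinquityOn Set.univ X Y

/-- `T` contains the tunnels that come from bridges between members of `C`: every quadruple
`(A ⊕ B, max {L_A, L_B, bn_γ / r}, pr₁, pr₂)` with `r` larger than the length of the bridge `γ`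
that is a tunnel belongs to `T`. -/
def ContainsBridgeTunnels (C : Set LQCMS.{u}) (T : TunnelClass.{u}) : Prop :=
  ∀ X ∈ C, ∀ Y ∈ C, ∀ (γ : Bridge X Y) (r : ℝ≥0), γ.length < r →
    ∀ (hL : IsLeibnizLipNorm (γ.sumNorm r))
      (h₁ : IsQuotient (StarAlgHom.fst ℂ X Y) (γ.sumNorm r) X.L)
      (h₂ : IsQuotient (StarAlgHom.snd ℂ X Y) (γ.sumNorm r) Y.L),
      Tunnel.ofSum (γ.sumNorm r) hL h₁ h₂ ∈ T X Y

end Propinquity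

end

/-! All the inequalities come from building seminorms `max {L_A, L_B, N}` on `A ⊕ B`, or from
regarding one path as another.

Such a maximum is a Lip-norm as soon as `N` is a bounded seminorm with `N (1, 1) = 0` and `N (0, 1)
≠ 0` (`IsSumBridge.isLipNorm`). This rests on Rieffel's criterion, proved in both directions: a
seminorm with dense domain and kernel `ℝ1` is a Lip-norm exactly when its unit ball is totally
bounded modulo constants.

For `dist_q ≤ Λ*`, a journey runs through several algebras, none of which need be a direct sum. What
is kept of a tunnel is a coupling: the relation "at distance at most `r` in the state space of `D`",
together with the fact that an element with Lipschitz seminorm below `s` lifts to `D` and descends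
to the other side with an error at most `s * r` on related states. Couplings compose and their
errors add, so a whole journey yields one coupling whose error is any number above its length. Then
`N (a, b) = sup |φ a - ψ b| / r` over related states gives an admissible Lip-norm. It need not be
Leibniz, and `dist_q` does not ask for that. Only the reach of the tunnels enters.

For `Λ* ≤ 2Λ`, take `N = ‖π_A(a) ω - ω π_B(b)‖ / r` with `r` above the length of the bridge. The map
`(a, b) ↦ π_A(a) ω - ω π_B(b)` is a twisted derivation, whence the Leibniz inequalities, and the
reach of the bridge gives the quotients. A state of `A` is moved at cost `r` to the restriction of a
state in the level set of `ω` (height); such a state does not distinguish `ω` from `1`, so its two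
restrictions are again at distance at most `r`. Hence the factor `2`.

Tunnels on a direct sum have depth zero, because every state of `A ⊕ B` is a convex combination of
states of the summands. Their length is thus the Hausdorff distance used by `dist_q` and `prox`, so
a competitor for `prox` is a journey with one tunnel. The remaining comparisons hold because
enlarging the classes only adds journeys. -/

noncomputable section

namespace Propinquity

/-! ## States -/

section States

variable {A : Type u} [CStarAlgebra A]

attribute [local instance] CStarAlgebra.spectralOrder CStarAlgebra.spectralOrderedRing

namespace StateSpace

/-- A state as a positive linear map, for the spectral order. -/
def toPositive (φ : StateSpace A) : A →ₚ[ℂ] ℂ :=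
  PositiveLinearMap.mk₀ (WeakDual.toStrongDual φ.toDual : A →L[ℂ] ℂ).toLinearMap fun x hx => by
    obtain ⟨y, rfl⟩ := CStarAlgebra.nonneg_iff_eq_star_mul_self.mp hx
    exact φ.nonneg y

lemma toPositive_apply (φ : StateSpace A) (a : A) : φ.toPositive a = φ a := rfl

@[ext]
lemma ext {φ ψ : StateSpace A} (h : ∀ a, φ a = ψ a) : φ = ψ := by
  obtain ⟨f, _, _⟩ := φ
  obtain ⟨g, _, _⟩ := ψ
  have : f = g := DFunLike.ext _ _ h
  subst this
  rfl

/-- The Cauchy-Schwarz inequality for states. -/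
lemma norm_apply_star_mul_le (φ : StateSpace A) (a b : A) :
    ‖φ (star a * b)‖ ≤ √(φ (star a * a)).re * √(φ (star b * b)).re := by
  have h := norm_inner_le_norm (𝕜 := ℂ) (φ.toPositive.toPreGNS a) (φ.toPositive.toPreGNS b)
  rw [PositiveLinearMap.preGNS_inner_def, PositiveLinearMap.preGNS_norm_def,
    PositiveLinearMap.preGNS_norm_def] at h
  exact h

/-- By Cauchy-Schwarz, a null vector of `φ` is orthogonal to everything. With `u = 1 - ω` this lets
the level set treat the pivot as `1`; with `u = (1, 0)` it shows that a state without mass on a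
summand vanishes there. -/
lemma apply_star_mul_eq_zero (φ : StateSpace A) {u : A} (hu : φ (star u * u) = 0) (x : A) :
    φ (star x * u) = 0 := by
  have h := φ.norm_apply_star_mul_le x u
  rw [hu] at h
  simpa using h

lemma apply_mul_eq_zero (φ : StateSpace A) {u : A} (hu : φ (star u * u) = 0) (x : A) :
    φ (x * u) = 0 := by
  simpa using φ.apply_star_mul_eq_zero hu (star x)

lemma apply_mul_eq_zero' (φ : StateSpace A) {u : A} (hu : φ (u * star u) = 0) (x : A) :
    φ (u * x) = 0 := by
  have h := φ.norm_apply_star_mul_le (star u) x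
  rw [star_star, hu] at h
  simpa using h

lemma apply_star (φ : StateSpace A) (a : A) : φ (star a) = star (φ a) :=
  map_star φ.toPositive a

lemma norm_apply_le (φ : StateSpace A) (a : A) : ‖φ a‖ ≤ ‖a‖ := by
  have h := φ.norm_apply_star_mul_le 1 a
  have h1 : (φ (star a * a)).re ≤ ‖a‖ ^ 2 := by
    have h2 : φ.toPositive (star a * a) ≤ φ.toPositive (algebraMap ℝ A (‖a‖ ^ 2)) :=
      OrderHomClass.mono φ.toPositive CStarAlgebra.star_mul_le_algebraMap_norm_sq
    rw [Algebra.algebraMap_eq_smul_one, ← Complex.coe_smul, map_smul, toPositive_apply,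
      toPositive_apply, φ.map_one] at h2
    have := (Complex.le_def.mp h2).1
    simpa [← Complex.ofReal_pow] using this
  simp only [star_one, one_mul, φ.map_one, Complex.one_re, Real.sqrt_one] at h
  exact h.trans (Real.sqrt_le_iff.mpr ⟨norm_nonneg a, h1⟩)

/-- The real value of a state at a self-adjoint element. -/
def val (φ : StateSpace A) (a : selfAdjoint A) : ℝ := (φ (a : A)).re

lemma apply_eq_val (φ : StateSpace A) (a : selfAdjoint A) : φ (a : A) = (φ.val a : ℂ) := by
  have h := φ.apply_star (a : A)
  rw [a.2.star_eq] at h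
  exact (Complex.conj_eq_iff_re.mp h.symm).symm

/-- A functional of norm one that is unital is positive. -/
def ofNormLEOne (f : StrongDual ℂ A) (hf : ‖f‖ ≤ 1) (h1 : f 1 = 1) : StateSpace A where
  toDual := StrongDual.toWeakDual f
  map_one := h1
  nonneg := by
    have hb : ∀ a, ‖f a‖ ≤ ‖a‖ := fun a =>
      (f.le_of_opNorm_le hf a).trans (one_mul _).le
    intro a
    rcases subsingleton_or_nontrivial A with hA | hA
    · rw [Subsingleton.elim (star a * a) 0]
      exact (map_zero f).ge
    set p := star a * a with hp
    have hsa : IsSelfAdjoint p := .star_mul_self a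
    have hp0 : 0 ≤ p := star_mul_self_nonneg a
    change 0 ≤ f p
    have him : (f p).im = 0 := by
      -- Test `f` on `p + it`, whose squared norm is at most `‖p‖ ^ 2 + t ^ 2` by the C*-identity.
      -- The squares of `t` cancel and leave a bound on a term linear in `t`, which fails for the
      -- `t` chosen below unless `(f p).im = 0`.
      have key : ∀ t : ℝ, ((f p).im + t) ^ 2 ≤ ‖p‖ ^ 2 + t ^ 2 := by
        intro t
        have e1 : star (p + (t * Complex.I : ℂ) • (1 : A)) * (p + (t * Complex.I : ℂ) • (1 : A))
            = p * p + ((t : ℂ) ^ 2) • (1 : A) := by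
          rw [star_add, star_smul, hsa.star_eq, star_one]
          simp only [mul_add, add_mul, smul_mul_assoc, mul_smul_comm, one_mul, mul_one]
          have e2 : star (t * Complex.I : ℂ) = -(t * Complex.I) := by simp
          have e3 : (t * Complex.I : ℂ) * -(t * Complex.I) = (t : ℂ) ^ 2 := by
            linear_combination (-(t : ℂ) ^ 2) * Complex.I_sq
          rw [e2, smul_add, smul_smul, e3, neg_smul]
          abel
        have e4 : ‖p + (t * Complex.I : ℂ) • (1 : A)‖ ^ 2 ≤ ‖p‖ ^ 2 + t ^ 2 := by
          rw [sq, ← CStarRing.norm_star_mul_self, e1]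
          refine (norm_add_le _ _).trans (add_le_add ?_ ?_)
          · exact (norm_mul_le _ _).trans (sq _).ge
          · rw [norm_smul, norm_one]
            simp
        have e5 := hb (p + (t * Complex.I : ℂ) • (1 : A))
        rw [map_add, map_smul, h1] at e5
        have e6 : |(f p).im + t| ≤ ‖f p + (t * Complex.I : ℂ) • (1 : ℂ)‖ := by
          refine le_trans (le_of_eq ?_) (Complex.abs_im_le_norm _)
          simp
        have e7 := e6.trans e5
        rw [← sq_abs]
        exact (pow_le_pow_left₀ (abs_nonneg _) e7 2).trans e4
      by_contra hne
      have := key ((‖p‖ ^ 2 + 1) / (2 * (f p).im))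
      have e : ((f p).im + (‖p‖ ^ 2 + 1) / (2 * (f p).im)) ^ 2
          = (f p).im ^ 2 + (‖p‖ ^ 2 + 1) + ((‖p‖ ^ 2 + 1) / (2 * (f p).im)) ^ 2 := by
        field_simp
        ring
      rw [e] at this
      nlinarith [sq_nonneg (f p).im]
    have hre : 0 ≤ (f p).re := by
      -- As `0 ≤ p`, the element `‖p‖ - p` lies between `0` and `‖p‖`; applying `f` gives `‖p‖ - re
      -- (f p) ≤ ‖p‖`.
      have e1 : ‖algebraMap ℝ A ‖p‖ - p‖ ≤ ‖p‖ := by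
        have h0 : 0 ≤ algebraMap ℝ A ‖p‖ - p := sub_nonneg.mpr hsa.le_algebraMap_norm_self
        rw [CStarAlgebra.norm_le_iff_le_algebraMap _ (norm_nonneg p) h0]
        exact sub_le_self _ hp0
      have e2 := (hb _).trans e1
      rw [map_sub, Algebra.algebraMap_eq_smul_one, ← Complex.coe_smul, map_smul, h1] at e2
      have e3 := (Complex.re_le_norm _).trans e2
      simp at e3
      linarith
    exact Complex.nonneg_iff.mpr ⟨hre, him.symm⟩

lemma ofNormLEOne_apply (f : StrongDual ℂ A) (hf : ‖f‖ ≤ 1) (h1 : f 1 = 1) (a : A) :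
    ofNormLEOne f hf h1 a = f a := rfl

/-- The states determine the norm of self-adjoint elements. -/
lemma exists_norm_apply_eq [Nontrivial A] (a : selfAdjoint A) :
    ∃ φ : StateSpace A, ‖φ (a : A)‖ = ‖a‖ := by
  -- Take a Hahn-Banach functional `g` norming `‖b‖ + b`, which has norm `2‖b‖`. Both `‖b‖ * re (g
  -- 1)` and `re (g b)` are at most `‖b‖` and they add up to `2‖b‖`, so `re (g 1) = 1`; with `‖g 1‖
  -- ≤ 1` this forces `g 1 = 1`, and `g` is a state.
  have key : ∀ b : A, ‖b‖ ∈ spectrum ℝ b → 0 < ‖b‖ → ∃ φ : StateSpace A, φ b = (‖b‖ : ℂ) := by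
    intro b hb hpos
    have e1 : ‖b‖ + ‖b‖ ∈ spectrum ℝ (algebraMap ℝ A ‖b‖ + b) := by
      rwa [spectrum.add_mem_add_iff]
    have e2 : ‖algebraMap ℝ A ‖b‖ + b‖ = ‖b‖ + ‖b‖ := by
      refine le_antisymm ((norm_add_le _ _).trans (by simp)) ?_
      have := spectrum.norm_le_norm_of_mem e1
      rwa [Real.norm_of_nonneg (by positivity)] at this
    obtain ⟨g, hg, hg'⟩ := exists_dual_vector'' ℂ (algebraMap ℝ A ‖b‖ + b)
    have hb' : ∀ a, ‖g a‖ ≤ ‖a‖ := fun a => (g.le_of_opNorm_le hg a).trans (one_mul _).le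
    rw [e2, map_add, Algebra.algebraMap_eq_smul_one, ← Complex.coe_smul, map_smul] at hg'
    have hre : ‖b‖ * (g 1).re + (g b).re = ‖b‖ + ‖b‖ := by
      simpa using congrArg Complex.re hg'
    have hn1 : ‖g 1‖ ≤ 1 := (hb' 1).trans (by simp)
    have h1 : (g 1).re ≤ 1 := (Complex.re_le_norm _).trans hn1
    have hr1 : (g 1).re = 1 := by
      have h2 : (g b).re ≤ ‖b‖ := (Complex.re_le_norm _).trans (hb' b)
      nlinarith
    have hi1 : (g 1).im = 0 := by
      have := Complex.sq_norm (g 1)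
      rw [Complex.normSq_apply, hr1] at this
      nlinarith [norm_nonneg (g 1)]
    have h11 : g 1 = 1 := Complex.ext hr1 hi1
    refine ⟨ofNormLEOne g hg h11, ?_⟩
    rw [ofNormLEOne_apply]
    rw [h11] at hg'
    simp at hg'
    exact hg'
  rcases (norm_nonneg (a : A)).eq_or_lt with h0 | hpos
  · obtain ⟨g, hg, hg'⟩ := exists_dual_vector'' ℂ (1 : A)
    refine ⟨ofNormLEOne g hg (by simpa using hg'), ?_⟩
    have h00 : (a : A) = 0 := norm_eq_zero.mp h0.symm
    rw [ofNormLEOne_apply, h00, map_zero, norm_zero]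
    exact h0
  · rcases CStarAlgebra.norm_or_neg_norm_mem_spectrum a.2 with h | h
    · obtain ⟨φ, hφ⟩ := key a h hpos
      exact ⟨φ, by rw [hφ]; simp⟩
    · obtain ⟨φ, hφ⟩ := key (-a) (by rwa [norm_neg, ← spectrum.neg_eq, Set.mem_neg])
        (by rwa [norm_neg])
      refine ⟨φ, ?_⟩
      rw [← norm_neg, ← map_neg, hφ]
      simp

instance [Nontrivial A] : Nonempty (StateSpace A) :=
  let ⟨φ, _⟩ := exists_norm_apply_eq (0 : selfAdjoint A)
  ⟨φ⟩

lemma continuous_toDual : Continuous (StateSpace.toDual : StateSpace A → WeakDual ℂ A) :=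
  continuous_induced_dom

lemma continuous_apply (a : A) : Continuous fun φ : StateSpace A => φ a :=
  (WeakDual.eval_continuous a).comp continuous_toDual

/-- Banach-Alaoglu: the states form a weak*-closed subset of the dual unit ball. -/
instance : CompactSpace (StateSpace A) := by
  have hemb : Topology.IsInducing (StateSpace.toDual : StateSpace A → WeakDual ℂ A) := ⟨rfl⟩
  rw [← isCompact_univ_iff, hemb.isCompact_iff, Set.image_univ]
  have hrange : Set.range (StateSpace.toDual : StateSpace A → WeakDual ℂ A) =
      {f | (∀ a : A, 0 ≤ f (star a * a)) ∧ f 1 = 1} := by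
    ext f
    exact ⟨by rintro ⟨φ, rfl⟩; exact ⟨φ.nonneg, φ.map_one⟩, fun h => ⟨⟨f, h.1, h.2⟩, rfl⟩⟩
  refine (WeakDual.isCompact_closedBall (0 : StrongDual ℂ A) 1).of_isClosed_subset ?_ ?_
  · rw [hrange, Set.ofPred_and, Set.ofPred_forall]
    refine (isClosed_iInter fun a => ?_).inter ?_
    · exact isClosed_le continuous_const (WeakDual.eval_continuous _)
    · exact isClosed_eq (WeakDual.eval_continuous _) continuous_const
  · rintro _ ⟨φ, rfl⟩
    simp only [Set.mem_preimage, mem_closedBall_zero_iff]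
    exact ContinuousLinearMap.opNorm_le_bound _ zero_le_one fun a =>
      (φ.norm_apply_le a).trans (one_mul _).ge

end StateSpace

end States

/-! ## Lip-norms and total boundedness -/

section LipNorm

variable {A : Type u} [CStarAlgebra A]

/-- The state space with the topology of the Monge-Kantorovich metric. -/
def MKSpace (_L : selfAdjoint A → ℝ≥0∞) : Type u := StateSpace A

instance (L : selfAdjoint A → ℝ≥0∞) : PseudoEMetricSpace (MKSpace L) := mkEMetric L

/-- The identity from the weak* topology to the Monge-Kantorovich metric. -/
def MKSpace.of (L : selfAdjoint A → ℝ≥0∞) (φ : StateSpace A) : MKSpace L := φ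

/-- The identity from the Monge-Kantorovich metric to the weak* topology. -/
def MKSpace.toState {L : selfAdjoint A → ℝ≥0∞} (φ : MKSpace L) : StateSpace A := φ

lemma StateSpace.apply_real_smul (φ : StateSpace A) (r : ℝ) (a : selfAdjoint A) :
    φ ((r • a : selfAdjoint A) : A) = (r : ℂ) * φ (a : A) := by
  rw [selfAdjoint.val_smul, ← Complex.coe_smul r (a : A), map_smul, smul_eq_mul]

lemma enorm_sub_le_mk {L : selfAdjoint A → ℝ≥0∞} {a : selfAdjoint A} (ha : L a ≤ 1)
    (φ ψ : StateSpace A) : ‖φ (a : A) - ψ (a : A)‖ₑ ≤ mk L φ ψ :=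
  le_iSup₂ (f := fun (b : selfAdjoint A) (_ : L b ≤ 1) => ‖φ (b : A) - ψ (b : A)‖ₑ) a ha

lemma map_inv_smul_le_one {L : selfAdjoint A → ℝ≥0∞}
    (hsmul : ∀ (r : ℝ) a, L (r • a) = ‖r‖ₑ * L a) {a : selfAdjoint A} {s : ℝ≥0} (hs : s ≠ 0)
    (ha : L a ≤ s) : L ((s : ℝ)⁻¹ • a) ≤ 1 := by
  have hes : ‖(s : ℝ)‖ₑ = s := by simp
  rw [hsmul, enorm_inv (NNReal.coe_ne_zero.mpr hs), hes]
  exact (mul_le_mul_right ha _).trans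
    (ENNReal.inv_mul_cancel (by simpa using hs) ENNReal.coe_ne_top).le

lemma enorm_sub_le_mul_mk {L : selfAdjoint A → ℝ≥0∞}
    (hsmul : ∀ (r : ℝ) a, L (r • a) = ‖r‖ₑ * L a) {a : selfAdjoint A} {s : ℝ≥0} (hs : s ≠ 0)
    (ha : L a ≤ s) (φ ψ : StateSpace A) :
    ‖φ (a : A) - ψ (a : A)‖ₑ ≤ s * mk L φ ψ := by
  have hs' : (s : ℝ) ≠ 0 := NNReal.coe_ne_zero.mpr hs
  have hes : ‖(s : ℝ)‖ₑ = s := by simp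
  have h1 : L ((s : ℝ)⁻¹ • a) ≤ 1 := map_inv_smul_le_one hsmul hs ha
  have h2 : ∀ χ : StateSpace A, χ (a : A) = (s : ℝ) • χ (((s : ℝ)⁻¹ • a : selfAdjoint A) : A) := by
    intro χ
    rw [χ.apply_real_smul, Complex.real_smul, ← mul_assoc, ← Complex.ofReal_mul,
      mul_inv_cancel₀ hs', Complex.ofReal_one, one_mul]
  rw [h2 φ, h2 ψ, ← smul_sub, enorm_smul, hes]
  exact mul_le_mul_right (enorm_sub_le_mk h1 φ ψ) _

lemma StateSpace.apply_smul_one (φ : StateSpace A) (t : ℝ) :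
    φ ((t • (1 : selfAdjoint A) : selfAdjoint A) : A) = (t : ℂ) := by
  rw [φ.apply_real_smul, selfAdjoint.val_one, φ.map_one, mul_one]

lemma StateSpace.apply_sub_sub (φ ψ : StateSpace A) (t : ℝ) (a : selfAdjoint A) :
    φ ((a - t • (1 : selfAdjoint A) : selfAdjoint A) : A)
      - ψ ((a - t • (1 : selfAdjoint A) : selfAdjoint A) : A) = φ (a : A) - ψ (a : A) := by
  have h : ∀ χ : StateSpace A, χ ((a - t • (1 : selfAdjoint A) : selfAdjoint A) : A)
      = χ (a : A) - t := by
    intro χ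
    rw [AddSubgroupClass.coe_sub, map_sub, χ.apply_smul_one]
  rw [h, h]
  ring

lemma IsLipNorm.map_one {L : selfAdjoint A → ℝ≥0∞} (hL : IsLipNorm L) : L 1 = 0 :=
  (hL.eq_zero_iff 1).mpr ⟨1, (one_smul _ _).symm⟩

lemma map_sub_smul_one_le {L : selfAdjoint A → ℝ≥0∞} (hadd : ∀ a b, L (a + b) ≤ L a + L b)
    (hsmul : ∀ (r : ℝ) a, L (r • a) = ‖r‖ₑ * L a) (h1 : L 1 = 0) (a : selfAdjoint A) (t : ℝ) :
    L (a - t • (1 : selfAdjoint A)) ≤ L a := by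
  rw [sub_eq_add_neg, ← neg_smul]
  refine (hadd _ _).trans ?_
  rw [hsmul, h1]
  simp

/-- The Lipschitz ball of a Lip-norm, normalized at a state, is totally bounded. -/
theorem IsLipNorm.totallyBounded [Nontrivial A] {L : selfAdjoint A → ℝ≥0∞} (hL : IsLipNorm L)
    (φ₀ : StateSpace A) : TotallyBounded {a : selfAdjoint A | L a ≤ 1 ∧ φ₀ (a : A) = 0} := by
  set E : Set (selfAdjoint A) := {a | L a ≤ 1 ∧ φ₀ (a : A) = 0} with hE
  refine Metric.totallyBounded_of_finite_discretization fun ε hε => ?_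
  set δ : ℝ := ε / 4 with hδ
  have hδ0 : 0 < δ := by positivity
  have hcont : Continuous (MKSpace.of L) :=
    continuous_id_iff_le.mpr hL.topology_eq.ge
  -- An Arzelà-Ascoli argument. Balls for `mk` are weak* neighbourhoods, so finitely many of radius
  -- `δ` cover the compact state space. Elements of `E` are 1-Lipschitz for `mk`, so their values at
  -- the centres determine them up to `δ + 2δ + δ = ε`.
  obtain ⟨t, -, ht⟩ := (isCompact_univ (X := StateSpace A)).elim_nhds_subcover
    (fun φ => {ψ | Propinquity.mk L ψ φ < ENNReal.ofReal δ}) fun φ _ =>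
      hcont.continuousAt.preimage_mem_nhds
        (Metric.eball_mem_nhds (MKSpace.of L φ) (ENNReal.ofReal_pos.mpr hδ0))
  let T : selfAdjoint A → (t → ℂ) := fun a φ => (φ : StateSpace A) (a : A)
  have hTb : TotallyBounded (T '' E) := by
    suffices h : Bornology.IsBounded (T '' E) from
      h.isCompact_closure.totallyBounded.subset subset_closure
    -- An element of `E` vanishes at `φ₀`, so its value at `φ` is bounded by the finite number `mk L
    -- φ φ₀`.
    refine (Bornology.IsBounded.pi fun φ : t =>
      (Metric.isBounded_closedBall (x := (0 : ℂ)) (r := (Propinquity.mk L φ φ₀).toReal))).subset ?_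
    rintro _ ⟨a, ha, rfl⟩ φ -
    rw [mem_closedBall_zero_iff]
    have h1 := enorm_sub_le_mk ha.1 φ φ₀
    rw [ha.2, sub_zero] at h1
    have := ENNReal.toReal_mono (hL.mk_ne_top _ _) h1
    rwa [toReal_enorm] at this
  obtain ⟨u, -, hu, hcov⟩ := Metric.finite_approx_of_totallyBounded hTb δ hδ0
  have hF : ∀ x : E, ∃ y : u, dist (T x) y < δ := by
    intro x
    have := hcov ⟨x, x.2, rfl⟩
    simp only [Set.mem_iUnion, Metric.mem_ball, exists_prop] at this
    obtain ⟨y, hy, hxy⟩ := this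
    exact ⟨⟨y, hy⟩, hxy⟩
  choose F hF using hF
  refine ⟨u, hu.fintype, F, fun x y hxy => ?_⟩
  have hTxy : dist (T x) (T y) < 2 * δ := by
    have h1 := hF x
    have h2 := hF y
    rw [← hxy] at h2
    calc _ ≤ dist (T x) (F x) + dist (T y) (F x) := dist_triangle_right _ _ _
      _ < 2 * δ := by linarith
  obtain ⟨φ, hφ⟩ := StateSpace.exists_norm_apply_eq ((x : selfAdjoint A) - (y : selfAdjoint A))
  have hmem := ht (Set.mem_univ φ)
  simp only [Set.mem_iUnion, exists_prop] at hmem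
  obtain ⟨ψ, hψ, hφψ⟩ := hmem
  have hnear : ∀ z : E, ‖φ ((z : selfAdjoint A) : A) - ψ ((z : selfAdjoint A) : A)‖ ≤ δ := by
    intro z
    have h1 := (enorm_sub_le_mk z.2.1 φ ψ).trans (le_of_lt hφψ)
    have := ENNReal.toReal_mono ENNReal.ofReal_ne_top h1
    rwa [toReal_enorm, ENNReal.toReal_ofReal hδ0.le] at this
  have hmid : ‖ψ ((x : selfAdjoint A) : A) - ψ ((y : selfAdjoint A) : A)‖ < 2 * δ := by
    rw [← dist_eq_norm]
    exact (dist_le_pi_dist (T x) (T y) ⟨ψ, hψ⟩).trans_lt hTxy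
  rw [Subtype.dist_eq, dist_eq_norm]
  refine lt_of_eq_of_lt hφ.symm ?_
  rw [AddSubgroupClass.coe_sub, map_sub]
  calc ‖φ ((x : selfAdjoint A) : A) - φ ((y : selfAdjoint A) : A)‖
      = ‖(φ ((x : selfAdjoint A) : A) - ψ ((x : selfAdjoint A) : A))
          + (ψ ((x : selfAdjoint A) : A) - ψ ((y : selfAdjoint A) : A))
          + (ψ ((y : selfAdjoint A) : A) - φ ((y : selfAdjoint A) : A))‖ := by
        congr 1; ring
    _ ≤ _ := norm_add₃_le
    _ < δ + 2 * δ + δ := by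
        have h3 := hnear y
        rw [norm_sub_rev] at h3
        linarith [hnear x]
    _ = ε := by rw [hδ]; ring

/-- A seminorm whose Lipschitz ball is totally bounded modulo the constants is a Lip-norm. -/
theorem IsLipNorm.of_totallyBounded {L : selfAdjoint A → ℝ≥0∞}
    (hadd : ∀ a b, L (a + b) ≤ L a + L b) (hsmul : ∀ (r : ℝ) a, L (r • a) = ‖r‖ₑ * L a)
    (hdense : Dense {a | L a < ∞})
    (hzero : ∀ a, L a = 0 ↔ ∃ r : ℝ, a = r • (1 : selfAdjoint A))
    {E : Set (selfAdjoint A)} (hE : TotallyBounded E)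
    (hLE : ∀ a, L a ≤ 1 → ∃ t : ℝ, a - t • (1 : selfAdjoint A) ∈ E) : IsLipNorm L where
  add_le := hadd
  smul := hsmul
  dense_dom := hdense
  eq_zero_iff := hzero
  mk_ne_top φ ψ := by
    obtain ⟨R, hR⟩ := hE.isBounded.exists_norm_le
    refine ne_top_of_le_ne_top (ENNReal.ofReal_ne_top (r := R + R)) (iSup₂_le fun a ha => ?_)
    obtain ⟨t, ht⟩ := hLE a ha
    rw [← StateSpace.apply_sub_sub φ ψ t, ← ofReal_norm]
    exact ENNReal.ofReal_le_ofReal ((norm_sub_le _ _).trans (add_le_add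
      ((φ.norm_apply_le _).trans (hR _ ht)) ((ψ.norm_apply_le _).trans (hR _ ht))))
  topology_eq := by
    have hfwd : Continuous (MKSpace.toState (L := L)) := by
      have hsa : ∀ b : selfAdjoint A,
          Continuous fun φ : MKSpace L => φ.toState (b : A) := by
        intro b
        refine continuous_iff_continuousAt.mpr fun φ => ?_
        refine Metric.tendsto_nhds.mpr fun ε hε => ?_
        obtain ⟨b', hb', hbb'⟩ := Metric.mem_closure_iff.mp (hdense b) (ε / 3) (by positivity)
        obtain ⟨K, hK⟩ : ∃ K : ℝ≥0, (K : ℝ≥0∞) = L b' := ⟨_, ENNReal.coe_toNNReal hb'.ne⟩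
        -- The Lipschitz constant is taken to be `K + 1` rather than `K`, since `L b'` may be `0`.
        have hnb : Metric.eball φ (ENNReal.ofReal (ε / 3 / (K + 1))) ∈ nhds φ :=
          Metric.eball_mem_nhds _ (ENNReal.ofReal_pos.mpr (by positivity))
        filter_upwards [hnb] with ψ hψ
        have hψ' : Propinquity.mk L ψ φ < ENNReal.ofReal (ε / 3 / (K + 1)) := hψ
        have h1 : ‖ψ.toState (b' : A) - φ.toState (b' : A)‖ ≤ ε / 3 := by
          have h2 := enorm_sub_le_mul_mk (s := K + 1) hsmul (by positivity)
            (by rw [← hK]; exact_mod_cast (le_add_of_nonneg_right zero_le_one)) ψ φ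
          have h3 := h2.trans (mul_le_mul_right hψ'.le _)
          rw [← ofReal_norm, ← ENNReal.ofReal_coe_nnreal,
            ← ENNReal.ofReal_mul (by positivity)] at h3
          have h4 := (ENNReal.ofReal_le_ofReal_iff (by positivity)).mp h3
          refine h4.trans (le_of_eq ?_)
          push_cast
          field_simp
        have hd : ∀ χ : StateSpace A, ‖χ (b : A) - χ (b' : A)‖ < ε / 3 := by
          intro χ
          rw [← map_sub]
          refine (χ.norm_apply_le _).trans_lt ?_
          rw [← dist_eq_norm]
          exact hbb'
        rw [dist_eq_norm]
        calc ‖ψ.toState (b : A) - φ.toState (b : A)‖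
            = ‖(ψ.toState (b : A) - ψ.toState (b' : A))
              + (ψ.toState (b' : A) - φ.toState (b' : A))
              + (φ.toState (b' : A) - φ.toState (b : A))‖ := by
              congr 1; ring
          _ ≤ _ := norm_add₃_le
          _ < ε / 3 + ε / 3 + ε / 3 := by
              have h5 := hd φ.toState
              rw [norm_sub_rev] at h5
              have h6 := hd ψ.toState
              linarith
          _ = ε := by ring
      refine continuous_induced_rng.mpr (WeakDual.continuous_of_continuous_eval fun a => ?_)
      have ha : ∀ φ : StateSpace A, φ a
          = φ ((realPart a : selfAdjoint A) : A)
            + Complex.I * φ ((imaginaryPart a : selfAdjoint A) : A) := by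
        intro φ
        conv_lhs => rw [← realPart_add_I_smul_imaginaryPart a]
        rw [map_add, map_smul, smul_eq_mul]
      refine Continuous.congr ?_ fun φ => (ha φ.toState).symm
      exact (hsa _).add (continuous_const.mul (hsa _))
    have hbwd : Continuous (MKSpace.of L) := by
      refine continuous_iff_continuousAt.mpr fun φ => ?_
      refine (Metric.nhds_basis_eball (x := (MKSpace.of L φ))).tendsto_right_iff.mpr fun ε hε => ?_
      obtain ⟨δ, hδ0, hδε⟩ := ENNReal.lt_iff_exists_nnreal_btwn.mp hε
      have hδ : (0 : ℝ) < δ / 4 := by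
        have : (0 : ℝ) < δ := by exact_mod_cast hδ0
        positivity
      -- Being close to `φ` on a finite net of `E` is a weak* open condition. It controls `ψ - φ` on
      -- all of `E`, hence on the Lipschitz ball, as constants cancel in `ψ - φ`.
      obtain ⟨t, htf, ht⟩ := Metric.totallyBounded_iff.mp hE (δ / 4) hδ
      have hnear : ∀ᶠ ψ : StateSpace A in nhds φ, ∀ c ∈ t,
          ‖ψ ((c : selfAdjoint A) : A) - φ (c : A)‖ < δ / 4 := by
        refine (Filter.eventually_all_finite htf).mpr fun c _ => ?_
        have := Metric.tendsto_nhds.mp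
          ((StateSpace.continuous_apply (c : A)).continuousAt (x := φ) |>.tendsto) (δ / 4) hδ
        simpa only [dist_eq_norm] using this
      filter_upwards [hnear] with ψ hψ
      refine lt_of_le_of_lt (iSup₂_le fun a ha => ?_) hδε
      obtain ⟨r, hr⟩ := hLE a ha
      have hc := ht hr
      simp only [Set.mem_iUnion, exists_prop, Metric.mem_ball] at hc
      obtain ⟨c, hct, hc⟩ := hc
      change ‖ψ (a : A) - φ (a : A)‖ₑ ≤ δ
      rw [← StateSpace.apply_sub_sub _ _ r a]
      set x : selfAdjoint A := a - r • (1 : selfAdjoint A)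
      have hd : ∀ χ : StateSpace A, ‖χ (x : A) - χ (c : A)‖ < δ / 4 := by
        intro χ
        rw [← map_sub]
        refine (χ.norm_apply_le _).trans_lt ?_
        rw [← dist_eq_norm]
        exact hc
      rw [← ofReal_norm, ← ENNReal.ofReal_coe_nnreal]
      refine ENNReal.ofReal_le_ofReal ?_
      calc ‖ψ (x : A) - φ (x : A)‖
          = ‖(ψ (x : A) - ψ (c : A)) + (ψ (c : A) - φ (c : A)) + (φ (c : A) - φ (x : A))‖ := by
            congr 1; ring
        _ ≤ _ := norm_add₃_le
        _ ≤ δ / 4 + δ / 4 + δ / 4 := by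
            have h5 := hd φ
            rw [norm_sub_rev] at h5
            have h6 := hd ψ
            have h7 := hψ c hct
            linarith
        _ ≤ δ := by linarith
    exact le_antisymm (continuous_id_iff_le.mp hfwd) (continuous_id_iff_le.mp hbwd)

end LipNorm

/-! ## Lip-norms on direct sums -/

lemma totallyBounded_prod {α β : Type*} [PseudoMetricSpace α] [PseudoMetricSpace β] {s : Set α}
    {t : Set β} (hs : TotallyBounded s) (ht : TotallyBounded t) : TotallyBounded (s ×ˢ t) := by
  refine Metric.totallyBounded_iff.mpr fun ε hε => ?_
  obtain ⟨u, hu, hsu⟩ := Metric.totallyBounded_iff.mp hs ε hε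
  obtain ⟨v, hv, htv⟩ := Metric.totallyBounded_iff.mp ht ε hε
  refine ⟨u ×ˢ v, hu.prod hv, ?_⟩
  rintro ⟨x, y⟩ ⟨hx, hy⟩
  obtain ⟨x', hx', hxx'⟩ := Set.mem_iUnion₂.mp (hsu hx)
  obtain ⟨y', hy', hyy'⟩ := Set.mem_iUnion₂.mp (htv hy)
  refine Set.mem_iUnion₂.mpr ⟨(x', y'), ⟨hx', hy'⟩, ?_⟩
  rw [← ball_prod_same]
  exact ⟨hxx', hyy'⟩

section Sum

variable {X Y : LQCMS.{u}}

/-- The self-adjoint element `(a, b)` of `A ⊕ B`. -/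
def saPair (a : selfAdjoint X) (b : selfAdjoint Y) : selfAdjoint (X × Y) :=
  ⟨((a : X), (b : Y)), Prod.ext a.2.star_eq b.2.star_eq⟩

/-- The first coordinate of a self-adjoint element. -/
abbrev saFst (c : selfAdjoint (X × Y)) : selfAdjoint X := saMap (StarAlgHom.fst ℂ X Y) c

/-- The second coordinate of a self-adjoint element. -/
abbrev saSnd (c : selfAdjoint (X × Y)) : selfAdjoint Y := saMap (StarAlgHom.snd ℂ X Y) c

@[simp] lemma saFst_saPair (a : selfAdjoint X) (b : selfAdjoint Y) : saFst (saPair a b) = a := rfl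

@[simp] lemma saSnd_saPair (a : selfAdjoint X) (b : selfAdjoint Y) : saSnd (saPair a b) = b := rfl

lemma saPair_saFst_saSnd (c : selfAdjoint (X × Y)) : saPair (saFst c) (saSnd c) = c := rfl

lemma continuous_saFst : Continuous (saFst (X := X) (Y := Y)) :=
  (continuous_fst.comp continuous_subtype_val).subtype_mk _

lemma continuous_saSnd : Continuous (saSnd (X := X) (Y := Y)) :=
  (continuous_snd.comp continuous_subtype_val).subtype_mk _

lemma uniformContinuous_saPair :
    UniformContinuous fun p : selfAdjoint X × selfAdjoint Y => saPair p.1 p.2 :=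
  ((uniformContinuous_subtype_val.comp uniformContinuous_fst).prodMk
    (uniformContinuous_subtype_val.comp uniformContinuous_snd)).subtype_mk _

lemma norm_saPair (a : selfAdjoint X) (b : selfAdjoint Y) : ‖saPair a b‖ = max ‖a‖ ‖b‖ := rfl

/-- The seminorm `max {L_A(a), L_B(b), N(a, b)}` on `A ⊕ B`. -/
def sumSeminorm (X Y : LQCMS.{u}) (N : selfAdjoint (X × Y) → ℝ≥0∞) (c : selfAdjoint (X × Y)) :
    ℝ≥0∞ :=
  max (max (X.L (saFst c)) (Y.L (saSnd c))) (N c)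

lemma sumSeminorm_le_iff {N : selfAdjoint (X × Y) → ℝ≥0∞} {c : selfAdjoint (X × Y)} {s : ℝ≥0∞} :
    sumSeminorm X Y N c ≤ s ↔ (X.L (saFst c) ≤ s ∧ Y.L (saSnd c) ≤ s) ∧ N c ≤ s := by
  simp only [sumSeminorm, max_le_iff]

/-- A bounded seminorm on `A ⊕ B` that vanishes at the unit but not at `(0, 1)`. -/
structure IsSumBridge (N : selfAdjoint (X × Y) → ℝ≥0∞) : Prop where
  add_le : ∀ a b, N (a + b) ≤ N a + N b
  smul : ∀ (r : ℝ) a, N (r • a) = ‖r‖ₑ * N a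
  bound : ∃ K : ℝ≥0, ∀ a, N a ≤ K * ‖a‖ₑ
  map_one : N 1 = 0
  map_zero_one : N (saPair 0 1) ≠ 0

/-- Subtracting a scalar from each coordinate moves the unit ball into the product of the two
normalized Lipschitz balls. Modulo constants the only freedom left is the difference of the two
scalars, which `N` bounds because `N (0, 1) ≠ 0`. -/
theorem IsSumBridge.isLipNorm {N : selfAdjoint (X × Y) → ℝ≥0∞} (hN : IsSumBridge N) :
    IsLipNorm (sumSeminorm X Y N) := by
  have hX := X.isLeibnizLipNorm.toIsLipNorm
  have hY := Y.isLeibnizLipNorm.toIsLipNorm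
  obtain ⟨K, hK⟩ := hN.bound
  have hNtop : ∀ c, N c ≠ ∞ := fun c =>
    ne_top_of_le_ne_top (ENNReal.mul_ne_top ENNReal.coe_ne_top enorm_ne_top) (hK c)
  have hadd : ∀ a b, sumSeminorm X Y N (a + b) ≤ sumSeminorm X Y N a + sumSeminorm X Y N b := by
    intro a b
    have ha := (sumSeminorm_le_iff (N := N) (c := a)).mp le_rfl
    have hb := (sumSeminorm_le_iff (N := N) (c := b)).mp le_rfl
    exact sumSeminorm_le_iff.mpr
      ⟨⟨(hX.add_le (saFst a) (saFst b)).trans (add_le_add ha.1.1 hb.1.1),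
        (hY.add_le (saSnd a) (saSnd b)).trans (add_le_add ha.1.2 hb.1.2)⟩,
        (hN.add_le a b).trans (add_le_add ha.2 hb.2)⟩
  have hsmul : ∀ (r : ℝ) a, sumSeminorm X Y N (r • a) = ‖r‖ₑ * sumSeminorm X Y N a := by
    intro r a
    have h1 : X.L (saFst (r • a)) = ‖r‖ₑ * X.L (saFst a) := hX.smul r (saFst a)
    have h2 : Y.L (saSnd (r • a)) = ‖r‖ₑ * Y.L (saSnd a) := hY.smul r (saSnd a)
    simp only [sumSeminorm, h1, h2, hN.smul, mul_max]
  have hone : sumSeminorm X Y N 1 = 0 :=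
    le_antisymm (sumSeminorm_le_iff.mpr
      ⟨⟨hX.map_one.le, hY.map_one.le⟩, hN.map_one.le⟩) bot_le
  have hsub : ∀ c (s : ℝ), N (c - s • (1 : selfAdjoint (X × Y))) ≤ N c :=
    map_sub_smul_one_le hN.add_le hN.smul hN.map_one
  obtain ⟨φ₀⟩ := (inferInstance : Nonempty (StateSpace X))
  obtain ⟨ψ₀⟩ := (inferInstance : Nonempty (StateSpace Y))
  have hEX := hX.totallyBounded φ₀
  have hEY := hY.totallyBounded ψ₀
  set EX := {a : selfAdjoint X | X.L a ≤ 1 ∧ φ₀ (a : X) = 0}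
  set EY := {b : selfAdjoint Y | Y.L b ≤ 1 ∧ ψ₀ (b : Y) = 0}
  obtain ⟨RX, hRX⟩ := hEX.isBounded.exists_norm_le
  obtain ⟨RY, hRY⟩ := hEY.isBounded.exists_norm_le
  set B : ℝ≥0∞ := (1 + K * ENNReal.ofReal (max RX RY)) / N (saPair 0 1)
  have hBtop : B ≠ ∞ := ENNReal.div_ne_top (by finiteness) hN.map_zero_one
  let F : (selfAdjoint X × selfAdjoint Y) × ℝ → selfAdjoint (X × Y) := fun p =>
    saPair p.1.1 (p.1.2 + p.2 • (1 : selfAdjoint Y))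
  have hF : UniformContinuous F := by
    have h1 : UniformContinuous fun t : ℝ => t • (1 : selfAdjoint Y) :=
      (ContinuousLinearMap.toSpanSingleton ℝ (1 : selfAdjoint Y)).uniformContinuous
    exact uniformContinuous_saPair.comp
      ((uniformContinuous_fst.comp uniformContinuous_fst).prodMk
        ((uniformContinuous_snd.comp uniformContinuous_fst).add (h1.comp uniformContinuous_snd)))
  refine IsLipNorm.of_totallyBounded (E := F '' ((EX ×ˢ EY) ×ˢ Set.Icc (-B.toReal) B.toReal))
    hadd hsmul ?_ ?_ ?_ ?_
  · have hd := hX.dense_dom.prod hY.dense_dom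
    have hsurj : Function.Surjective
        fun p : selfAdjoint X × selfAdjoint Y => saPair p.1 p.2 :=
      fun c => ⟨(saFst c, saSnd c), rfl⟩
    refine (hsurj.denseRange.dense_image uniformContinuous_saPair.continuous hd).mono ?_
    rintro _ ⟨p, ⟨hp1, hp2⟩, rfl⟩
    exact max_lt (max_lt hp1 hp2) (lt_top_iff_ne_top.mpr (hNtop _))
  · intro c
    constructor
    · intro hc
      obtain ⟨⟨h1, h2⟩, h3⟩ := sumSeminorm_le_iff.mp hc.le
      obtain ⟨s, hs⟩ := (hX.eq_zero_iff _).mp (le_antisymm h1 bot_le)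
      obtain ⟨t, ht⟩ := (hY.eq_zero_iff _).mp (le_antisymm h2 bot_le)
      refine ⟨s, ?_⟩
      have hcs : c - s • (1 : selfAdjoint (X × Y)) = (t - s) • saPair 0 1 := by
        rw [← saPair_saFst_saSnd c, hs, ht]
        refine Subtype.ext (Prod.ext ?_ ?_)
        · simp [saPair]
        · simp [saPair, sub_smul]
      have h4 := (hsub c s).trans h3
      rw [hcs, hN.smul] at h4
      have h5 := (mul_eq_zero.mp (le_antisymm h4 bot_le)).resolve_right hN.map_zero_one
      rw [enorm_eq_zero] at h5
      rw [h5, zero_smul] at hcs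
      exact sub_eq_zero.mp hcs
    · rintro ⟨r, rfl⟩
      rw [hsmul, hone, mul_zero]
  · exact (totallyBounded_prod (totallyBounded_prod hEX hEY) isCompact_Icc.totallyBounded).image hF
  · intro c hc
    obtain ⟨⟨h1, h2⟩, h3⟩ := sumSeminorm_le_iff.mp hc
    set s := φ₀.val (saFst c)
    set t := ψ₀.val (saSnd c)
    have ha : saFst c - s • (1 : selfAdjoint X) ∈ EX := by
      refine ⟨(map_sub_smul_one_le hX.add_le hX.smul hX.map_one _ _).trans h1, ?_⟩
      rw [AddSubgroupClass.coe_sub, map_sub, φ₀.apply_smul_one, φ₀.apply_eq_val, sub_self]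
    have hb : saSnd c - t • (1 : selfAdjoint Y) ∈ EY := by
      refine ⟨(map_sub_smul_one_le hY.add_le hY.smul hY.map_one _ _).trans h2, ?_⟩
      rw [AddSubgroupClass.coe_sub, map_sub, ψ₀.apply_smul_one, ψ₀.apply_eq_val, sub_self]
    refine ⟨s, ((saFst c - s • 1, saSnd c - t • 1), t - s), ⟨⟨ha, hb⟩, ?_⟩, ?_⟩
    · have hdec : (t - s) • saPair (0 : selfAdjoint X) (1 : selfAdjoint Y)
          = (c - s • (1 : selfAdjoint (X × Y)))
            + (-1 : ℝ) • saPair (saFst c - s • 1) (saSnd c - t • 1) := by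
        obtain ⟨a, b, rfl⟩ : ∃ a b, c = saPair a b := ⟨saFst c, saSnd c, rfl⟩
        simp only [saFst_saPair, saSnd_saPair]
        refine Subtype.ext (Prod.ext ?_ ?_)
        · simp [saPair]
        · simp [saPair, sub_smul]
      have h4 : ‖t - s‖ₑ * N (saPair 0 1) ≤ 1 + K * ENNReal.ofReal (max RX RY) := by
        rw [← hN.smul, hdec]
        refine (hN.add_le _ _).trans (add_le_add ((hsub _ _).trans h3) ?_)
        rw [hN.smul, enorm_neg, enorm_one, one_mul]
        refine (hK _).trans (mul_le_mul_right ?_ _)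
        rw [← ofReal_norm, norm_saPair]
        exact ENNReal.ofReal_le_ofReal (max_le_max (hRX _ ha) (hRY _ hb))
      have h5 : ‖t - s‖ₑ ≤ B :=
        (ENNReal.le_div_iff_mul_le (Or.inl hN.map_zero_one) (Or.inl (hNtop _))).mpr h4
      have h6 := ENNReal.toReal_mono hBtop h5
      rw [toReal_enorm, Real.norm_eq_abs] at h6
      exact abs_le.mp h6
    · conv_rhs => rw [← saPair_saFst_saSnd c]
      refine Subtype.ext (Prod.ext ?_ ?_)
      · simp [F, saPair]
      · simp [F, saPair, sub_smul]

/-- The maximum dominates `L_A`, so only lifts of nearly equal seminorm are needed. The slack `s` is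
there because the infimum need not be attained. -/
lemma isQuotient_fst_sumSeminorm {N : selfAdjoint (X × Y) → ℝ≥0∞}
    (h : ∀ (a : selfAdjoint X) (s : ℝ≥0), X.L a < s →
      ∃ b : selfAdjoint Y, Y.L b ≤ s ∧ N (saPair a b) ≤ s) :
    IsQuotient (StarAlgHom.fst ℂ X Y) (sumSeminorm X Y N) X.L := by
  intro a
  refine le_antisymm (le_iInf₂ fun d hd => ?_) ?_
  · rw [← hd]
    exact (sumSeminorm_le_iff.mp le_rfl).1.1
  · by_contra! hlt
    obtain ⟨s, hs1, hs2⟩ := ENNReal.lt_iff_exists_nnreal_btwn.mp hlt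
    obtain ⟨b, hb, hN⟩ := h a s hs1
    refine absurd hs2 (not_lt.mpr ((iInf₂_le
      (f := fun (d : selfAdjoint (X × Y)) (_ : saFst d = a) => sumSeminorm X Y N d) (saPair a b) rfl).trans ?_))
    exact sumSeminorm_le_iff.mpr ⟨⟨hs1.le, hb⟩, hN⟩

lemma isQuotient_snd_sumSeminorm {N : selfAdjoint (X × Y) → ℝ≥0∞}
    (h : ∀ (b : selfAdjoint Y) (s : ℝ≥0), Y.L b < s →
      ∃ a : selfAdjoint X, X.L a ≤ s ∧ N (saPair a b) ≤ s) :
    IsQuotient (StarAlgHom.snd ℂ X Y) (sumSeminorm X Y N) Y.L := by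
  intro b
  refine le_antisymm (le_iInf₂ fun d hd => ?_) ?_
  · rw [← hd]
    exact (sumSeminorm_le_iff.mp le_rfl).1.2
  · by_contra! hlt
    obtain ⟨s, hs1, hs2⟩ := ENNReal.lt_iff_exists_nnreal_btwn.mp hlt
    obtain ⟨a, ha, hN⟩ := h b s hs1
    refine absurd hs2 (not_lt.mpr ((iInf₂_le
      (f := fun (d : selfAdjoint (X × Y)) (_ : saSnd d = b) => sumSeminorm X Y N d) (saPair a b) rfl).trans ?_))
    exact sumSeminorm_le_iff.mpr ⟨⟨ha, hs1.le⟩, hN⟩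

lemma sumHausdorff_le {L : selfAdjoint (X × Y) → ℝ≥0∞} {r : ℝ≥0∞}
    (h₁ : ∀ φ : StateSpace X, ∃ ψ : StateSpace Y, ∀ c, L c ≤ 1 →
      ‖φ (saFst c : X) - ψ (saSnd c : Y)‖ₑ ≤ r)
    (h₂ : ∀ ψ : StateSpace Y, ∃ φ : StateSpace X, ∀ c, L c ≤ 1 →
      ‖φ (saFst c : X) - ψ (saSnd c : Y)‖ₑ ≤ r) :
    sumHausdorff X Y L ≤ r := by
  refine @Metric.hausdorffEDist_le_of_mem_edist _ (mkEMetric L) _ _ _ ?_ ?_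
  · rintro _ ⟨φ, rfl⟩
    obtain ⟨ψ, hψ⟩ := h₁ φ
    exact ⟨_, ⟨ψ, rfl⟩, iSup₂_le hψ⟩
  · rintro _ ⟨ψ, rfl⟩
    obtain ⟨φ, hφ⟩ := h₂ ψ
    refine ⟨_, ⟨φ, rfl⟩, iSup₂_le fun c hc => ?_⟩
    rw [← enorm_neg, neg_sub]
    exact hφ c hc

end Sum

/-! ## The quantum Gromov-Hausdorff distance and the dual propinquity -/

section Coupling

variable {X Y Z : LQCMS.{u}}

/-- A relation between two state spaces with full projections, along which Lipschitz elements
can be lifted with the error `r`. -/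
structure IsCoupling (R : StateSpace X → StateSpace Y → Prop) (r : ℝ≥0) : Prop where
  left_total : ∀ φ, ∃ ψ, R φ ψ
  right_total : ∀ ψ, ∃ φ, R φ ψ
  lift_left : ∀ (a : selfAdjoint X) (s : ℝ≥0), X.L a < s → ∃ b : selfAdjoint Y, Y.L b < s ∧
    ∀ φ ψ, R φ ψ → ‖φ (a : X) - ψ (b : Y)‖ₑ ≤ s * r
  lift_right : ∀ (b : selfAdjoint Y) (s : ℝ≥0), Y.L b < s → ∃ a : selfAdjoint X, X.L a < s ∧
    ∀ φ ψ, R φ ψ → ‖φ (a : X) - ψ (b : Y)‖ₑ ≤ s * r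

lemma IsQuotient.exists_lift {D A : Type u} [CStarAlgebra D] [CStarAlgebra A] {π : D →⋆ₐ[ℂ] A}
    {LD : selfAdjoint D → ℝ≥0∞} {L : selfAdjoint A → ℝ≥0∞} (h : IsQuotient π LD L)
    {a : selfAdjoint A} {s : ℝ≥0∞} (ha : L a < s) : ∃ d, saMap π d = a ∧ LD d < s := by
  rw [h a] at ha
  simpa only [iInf_lt_iff, exists_prop] using ha

lemma IsQuotient.le {D A : Type u} [CStarAlgebra D] [CStarAlgebra A] {π : D →⋆ₐ[ℂ] A}
    {LD : selfAdjoint D → ℝ≥0∞} {L : selfAdjoint A → ℝ≥0∞} (h : IsQuotient π LD L)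
    (d : selfAdjoint D) : L (saMap π d) ≤ LD d := by
  rw [h]
  exact iInf₂_le (f := fun (d : selfAdjoint D) (_ : saMap π d = _) => LD d) d rfl

/-- An element is lifted to `d` with `L_D d < s` and pushed to the other side. Both values are then
values at `d` of states of `D` at distance at most `r`, so they differ by at most `s * r`. -/
lemma Tunnel.isCoupling (τ : Tunnel X Y) {r : ℝ≥0} (hr : τ.reach < r) :
    IsCoupling (fun φ ψ => Propinquity.mk τ.D.L (φ.comap τ.left) (ψ.comap τ.right) ≤ r) r where
  left_total φ := by
    obtain ⟨_, ⟨ψ, rfl⟩, h⟩ := @Metric.exists_edist_lt_of_hausdorffEDist_lt _ (mkEMetric τ.D.L)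
      (φ.comap τ.left) _ _ _ (Set.mem_range_self φ) hr
    exact ⟨ψ, h.le⟩
  right_total ψ := by
    rw [Tunnel.reach, mkHausdorff, @Metric.hausdorffEDist_comm _ (mkEMetric τ.D.L)] at hr
    obtain ⟨_, ⟨φ, rfl⟩, h⟩ := @Metric.exists_edist_lt_of_hausdorffEDist_lt _ (mkEMetric τ.D.L)
      (ψ.comap τ.right) _ _ _ (Set.mem_range_self ψ) hr
    refine ⟨φ, le_trans (le_of_eq ?_) h.le⟩
    exact (mkEMetric τ.D.L).edist_comm _ _
  lift_left a s ha := by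
    obtain ⟨d, rfl, hd⟩ := τ.left_quotient.exists_lift ha
    refine ⟨saMap τ.right d, (τ.right_quotient.le d).trans_lt hd, fun φ ψ h => ?_⟩
    have hs : s ≠ 0 := by
      rintro rfl
      simp at ha
    exact (enorm_sub_le_mul_mk τ.D.isLeibnizLipNorm.smul hs hd.le (φ.comap τ.left)
      (ψ.comap τ.right)).trans (mul_le_mul_right h _)
  lift_right b s hb := by
    obtain ⟨d, rfl, hd⟩ := τ.right_quotient.exists_lift hb
    refine ⟨saMap τ.left d, (τ.left_quotient.le d).trans_lt hd, fun φ ψ h => ?_⟩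
    have hs : s ≠ 0 := by
      rintro rfl
      simp at hb
    exact (enorm_sub_le_mul_mk τ.D.isLeibnizLipNorm.smul hs hd.le (φ.comap τ.left)
      (ψ.comap τ.right)).trans (mul_le_mul_right h _)

/-- The intermediate lift obeys the same strict bound as the original element, so it can be lifted
again with the same `s`, and the triangle inequality adds the errors. -/
lemma IsCoupling.comp {R : StateSpace X → StateSpace Y → Prop} {r : ℝ≥0}
    {S : StateSpace Y → StateSpace Z → Prop} {s : ℝ≥0} (hR : IsCoupling R r)
    (hS : IsCoupling S s) : IsCoupling (fun φ χ => ∃ ψ, R φ ψ ∧ S ψ χ) (r + s) where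
  left_total φ := by
    obtain ⟨ψ, hψ⟩ := hR.left_total φ
    obtain ⟨χ, hχ⟩ := hS.left_total ψ
    exact ⟨χ, ψ, hψ, hχ⟩
  right_total χ := by
    obtain ⟨ψ, hψ⟩ := hS.right_total χ
    obtain ⟨φ, hφ⟩ := hR.right_total ψ
    exact ⟨φ, ψ, hφ, hψ⟩
  lift_left a t ha := by
    obtain ⟨b, hb, hab⟩ := hR.lift_left a t ha
    obtain ⟨c, hc, hbc⟩ := hS.lift_left b t hb
    refine ⟨c, hc, ?_⟩
    rintro φ χ ⟨ψ, h1, h2⟩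
    rw [← sub_add_sub_cancel _ (ψ (b : Y)), ENNReal.coe_add, mul_add]
    exact (enorm_add_le _ _).trans (add_le_add (hab _ _ h1) (hbc _ _ h2))
  lift_right c t hc := by
    obtain ⟨b, hb, hbc⟩ := hS.lift_right c t hc
    obtain ⟨a, ha, hab⟩ := hR.lift_right b t hb
    refine ⟨a, ha, ?_⟩
    rintro φ χ ⟨ψ, h1, h2⟩
    rw [← sub_add_sub_cancel _ (ψ (b : Y)), ENNReal.coe_add, mul_add]
    exact (enorm_add_le _ _).trans (add_le_add (hab _ _ h1) (hbc _ _ h2))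

lemma exists_nnreal_add_eq_of_add_lt {a b : ℝ≥0∞} {r : ℝ≥0} (h : a + b < r) :
    ∃ p q : ℝ≥0, a < p ∧ b < q ∧ p + q = r := by
  have ha : a ≠ ∞ := ne_top_of_lt (lt_of_le_of_lt le_self_add h)
  have hb : b ≠ ∞ := ne_top_of_lt (lt_of_le_of_lt le_add_self h)
  lift a to ℝ≥0 using ha
  lift b to ℝ≥0 using hb
  have h' : a + b < r := by exact_mod_cast h
  obtain ⟨e, rfl⟩ := exists_add_of_le h'.le
  have he : 0 < e := by
    by_contra! h0
    simp [le_antisymm h0 bot_le] at h'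
  have h2 : 0 < e / 2 := by positivity
  refine ⟨a + e / 2, b + e / 2, ?_, ?_, ?_⟩
  · exact_mod_cast lt_add_of_pos_right a h2
  · exact_mod_cast lt_add_of_pos_right b h2
  · rw [add_add_add_comm, add_halves]

lemma Journey.exists_isCoupling {C : Set LQCMS.{u}} {T : TunnelClass.{u}} (J : Journey C T X Y) :
    ∀ {r : ℝ≥0}, J.length < r → ∃ R : StateSpace X → StateSpace Y → Prop, IsCoupling R r := by
  induction J with
  | single hX hY τ hτ =>
    intro r hr
    exact ⟨_, τ.isCoupling ((le_max_left _ _).trans_lt hr)⟩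
  | cons hX τ hτ J ih =>
    intro r hr
    obtain ⟨p, q, hp, hq, rfl⟩ := exists_nnreal_add_eq_of_add_lt hr
    obtain ⟨S, hS⟩ := ih hq
    exact ⟨_, (τ.isCoupling ((le_max_left _ _).trans_lt hp)).comp hS⟩

/-- The bridge seminorm of a relation between state spaces. -/
def couplingSeminorm (R : StateSpace X → StateSpace Y → Prop) (r : ℝ≥0)
    (c : selfAdjoint (X × Y)) : ℝ≥0∞ :=
  (⨆ (φ : StateSpace X) (ψ : StateSpace Y) (_ : R φ ψ), ‖φ (saFst c : X) - ψ (saSnd c : Y)‖ₑ) / r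

lemma couplingSeminorm_le {R : StateSpace X → StateSpace Y → Prop} {r : ℝ≥0}
    {c : selfAdjoint (X × Y)} {s : ℝ≥0∞}
    (h : ∀ φ ψ, R φ ψ → ‖φ (saFst c : X) - ψ (saSnd c : Y)‖ₑ ≤ s * r) :
    couplingSeminorm R r c ≤ s :=
  ENNReal.div_le_of_le_mul (iSup_le fun φ => iSup₂_le fun ψ hψ => h φ ψ hψ)

lemma enorm_sub_le_mul_couplingSeminorm {R : StateSpace X → StateSpace Y → Prop} {r : ℝ≥0}
    (hr : r ≠ 0) (c : selfAdjoint (X × Y)) {φ : StateSpace X} {ψ : StateSpace Y} (h : R φ ψ) :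
    ‖φ (saFst c : X) - ψ (saSnd c : Y)‖ₑ ≤ couplingSeminorm R r c * r := by
  rw [couplingSeminorm, ENNReal.div_mul_cancel (by simpa using hr) ENNReal.coe_ne_top]
  exact (le_iSup₂ (f := fun (ψ : StateSpace Y) (_ : R φ ψ) =>
    ‖φ (saFst c : X) - ψ (saSnd c : Y)‖ₑ) ψ h).trans
    (le_iSup (fun φ : StateSpace X => ⨆ (ψ : StateSpace Y) (_ : R φ ψ),
      ‖φ (saFst c : X) - ψ (saSnd c : Y)‖ₑ) φ)

lemma IsCoupling.isSumBridge {R : StateSpace X → StateSpace Y → Prop} {r : ℝ≥0}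
    (hR : IsCoupling R r) (hr : r ≠ 0) : IsSumBridge (couplingSeminorm R r) where
  add_le c d := by
    refine couplingSeminorm_le fun φ ψ h => ?_
    have e : φ (saFst (c + d) : X) - ψ (saSnd (c + d) : Y)
        = (φ (saFst c : X) - ψ (saSnd c : Y)) + (φ (saFst d : X) - ψ (saSnd d : Y)) := by
      have e1 : φ (saFst (c + d) : X) = φ (saFst c : X) + φ (saFst d : X) :=
        map_add φ.toDual (saFst c : X) (saFst d : X)
      have e2 : ψ (saSnd (c + d) : Y) = ψ (saSnd c : Y) + ψ (saSnd d : Y) :=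
        map_add ψ.toDual (saSnd c : Y) (saSnd d : Y)
      rw [e1, e2]
      ring
    rw [e, add_mul]
    exact (enorm_add_le _ _).trans (add_le_add (enorm_sub_le_mul_couplingSeminorm hr c h)
      (enorm_sub_le_mul_couplingSeminorm hr d h))
  smul t c := by
    have e : ∀ (φ : StateSpace X) (ψ : StateSpace Y),
        ‖φ (saFst (t • c) : X) - ψ (saSnd (t • c) : Y)‖ₑ
          = ‖t‖ₑ * ‖φ (saFst c : X) - ψ (saSnd c : Y)‖ₑ := by
      intro φ ψ
      have e1 : φ (saFst (t • c) : X) = (t : ℂ) * φ (saFst c : X) := φ.apply_real_smul t (saFst c)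
      have e2 : ψ (saSnd (t • c) : Y) = (t : ℂ) * ψ (saSnd c : Y) := ψ.apply_real_smul t (saSnd c)
      rw [e1, e2, ← mul_sub, enorm_mul]
      congr 1
      simp [← ofReal_norm]
    simp only [couplingSeminorm, e, ← ENNReal.mul_iSup, mul_div_assoc]
  bound := by
    refine ⟨2 / r, fun c => couplingSeminorm_le fun φ ψ _ => ?_⟩
    have h1 : ‖φ (saFst c : X)‖ ≤ ‖c‖ := (φ.norm_apply_le _).trans (le_max_left _ _)
    have h2 : ‖ψ (saSnd c : Y)‖ ≤ ‖c‖ := (ψ.norm_apply_le _).trans (le_max_right _ _)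
    have h3 : ‖φ (saFst c : X) - ψ (saSnd c : Y)‖ₑ ≤ ‖c‖ₑ + ‖c‖ₑ :=
      enorm_sub_le.trans (add_le_add (enorm_le_iff_norm_le.mpr h1) (enorm_le_iff_norm_le.mpr h2))
    refine h3.trans (le_of_eq ?_)
    rw [ENNReal.coe_div hr, mul_right_comm, ENNReal.div_mul_cancel (by simpa using hr)
      ENNReal.coe_ne_top, ← two_mul]
    rfl
  map_one := by
    refine le_antisymm (couplingSeminorm_le fun φ ψ _ => ?_) bot_le
    have e1 : φ (saFst (1 : selfAdjoint (X × Y)) : X) = 1 := φ.map_one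
    have e2 : ψ (saSnd (1 : selfAdjoint (X × Y)) : Y) = 1 := ψ.map_one
    simp [e1, e2]
  map_zero_one h0 := by
    obtain ⟨φ⟩ := (inferInstance : Nonempty (StateSpace X))
    -- Totality makes the relation nonempty, and any related pair separates `0` from `1`.
    obtain ⟨ψ, h⟩ := hR.left_total φ
    have h1 := enorm_sub_le_mul_couplingSeminorm hr (saPair 0 1) h
    rw [h0, zero_mul, saFst_saPair, saSnd_saPair, selfAdjoint.val_one, ψ.map_one] at h1
    simp at h1

lemma IsCoupling.distQ_le {R : StateSpace X → StateSpace Y → Prop} {r : ℝ≥0}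
    (hR : IsCoupling R r) (hr : r ≠ 0) : distQ X Y ≤ r := by
  have hN := hR.isSumBridge hr
  have hadm : IsAdmissible X Y (sumSeminorm X Y (couplingSeminorm R r)) :=
    { hN.isLipNorm with
      quotient_fst := isQuotient_fst_sumSeminorm fun a s ha => by
        obtain ⟨b, hb, hab⟩ := hR.lift_left a s ha
        exact ⟨b, hb.le, couplingSeminorm_le hab⟩
      quotient_snd := isQuotient_snd_sumSeminorm fun b s hb => by
        obtain ⟨a, ha, hab⟩ := hR.lift_right b s hb
        exact ⟨a, ha.le, couplingSeminorm_le hab⟩ }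
  refine (iInf₂_le _ hadm).trans ((iInf_le _ fun c h1 h2 => ?_).trans ?_)
  -- The domain condition in `distQ`: the coupling seminorm is finite everywhere.
  · obtain ⟨K, hK⟩ := hN.bound
    exact max_lt (max_lt h1 h2) ((hK c).trans_lt
      (ENNReal.mul_lt_top ENNReal.coe_lt_top (lt_top_iff_ne_top.mpr enorm_ne_top)))
  · have key : ∀ φ ψ, R φ ψ → ∀ c, sumSeminorm X Y (couplingSeminorm R r) c ≤ 1 →
        ‖φ (saFst c : X) - ψ (saSnd c : Y)‖ₑ ≤ r := by
      intro φ ψ h c hc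
      refine (enorm_sub_le_mul_couplingSeminorm hr c h).trans ?_
      exact (mul_le_mul_left (sumSeminorm_le_iff.mp hc).2 _).trans (one_mul _).le
    refine sumHausdorff_le (fun φ => ?_) fun ψ => ?_
    · obtain ⟨ψ, h⟩ := hR.left_total φ
      exact ⟨ψ, key φ ψ h⟩
    · obtain ⟨φ, h⟩ := hR.right_total ψ
      exact ⟨φ, key φ ψ h⟩

theorem distQ_le_dualPropinquityOn (C : Set LQCMS.{u}) (T : TunnelClass.{u}) (X Y : LQCMS.{u}) :
    distQ X Y ≤ dualPropinquityOn C T X Y := by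
  refine le_iInf fun J => ?_
  by_contra! hlt
  obtain ⟨r, hr1, hr2⟩ := ENNReal.lt_iff_exists_nnreal_btwn.mp hlt
  obtain ⟨R, hR⟩ := J.exists_isCoupling hr1
  have hr : r ≠ 0 := by
    rintro rfl
    simp at hr1
  exact absurd hr2 (not_lt.mpr (hR.distQ_le hr))

end Coupling

/-! ## States of direct sums -/

section SumStates

variable {A D : Type u} [CStarAlgebra A] [CStarAlgebra D]

/-- The normalized restriction of a state to a direct summand on which it does not vanish. -/
def StateSpace.corner (φ : StateSpace D) (j : A →L[ℂ] D)
    (hj : ∀ a, j (star a * a) = star (j a) * j a) (t : ℝ) (ht : 0 < t) (h1 : φ (j 1) = t) :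
    StateSpace A where
  toDual := StrongDual.toWeakDual
    ((t⁻¹ : ℝ) • (WeakDual.toStrongDual φ.toDual).comp j)
  nonneg a := by
    change 0 ≤ (t⁻¹ : ℝ) • φ (j (star a * a))
    rw [hj]
    exact smul_nonneg (inv_nonneg.mpr ht.le) (φ.nonneg _)
  map_one := by
    change (t⁻¹ : ℝ) • φ (j 1) = 1
    rw [h1, Complex.real_smul, ← Complex.ofReal_mul, inv_mul_cancel₀ ht.ne', Complex.ofReal_one]

variable {X Y : LQCMS.{u}}

/-- Every state of a direct sum is a convex combination of states of the two summands. -/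
theorem StateSpace.mem_convexHull (φ : StateSpace (X × Y)) :
    φ.toDual ∈ convexHull ℝ (StateSpace.toDual ''
      (Set.range (StateSpace.comap (StarAlgHom.fst ℂ X Y)) ∪
        Set.range (StateSpace.comap (StarAlgHom.snd ℂ X Y)))) := by
  have hl : ∀ a : X, ContinuousLinearMap.inl ℂ X Y (star a * a)
      = star (ContinuousLinearMap.inl ℂ X Y a) * ContinuousLinearMap.inl ℂ X Y a := fun a =>
    Prod.ext rfl (by simp)
  have hr : ∀ b : Y, ContinuousLinearMap.inr ℂ X Y (star b * b)
      = star (ContinuousLinearMap.inr ℂ X Y b) * ContinuousLinearMap.inr ℂ X Y b := fun b =>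
    Prod.ext (by simp) rfl
  have hp : star ((1 : X), (0 : Y)) * ((1 : X), (0 : Y)) = (1, 0) := Prod.ext (by simp) (by simp)
  have hq : star ((0 : X), (1 : Y)) * ((0 : X), (1 : Y)) = (0, 1) := Prod.ext (by simp) (by simp)
  have hp0 := φ.nonneg ((1 : X), (0 : Y))
  have hq0 := φ.nonneg ((0 : X), (1 : Y))
  rw [hp] at hp0
  rw [hq] at hq0
  obtain ⟨t, ht⟩ : ∃ t : ℝ, φ ((1 : X), (0 : Y)) = t :=
    ⟨(φ ((1 : X), (0 : Y))).re, Complex.ext rfl (Complex.nonneg_iff.mp hp0).2.symm⟩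
  obtain ⟨v, hv⟩ : ∃ v : ℝ, φ ((0 : X), (1 : Y)) = v :=
    ⟨(φ ((0 : X), (1 : Y))).re, Complex.ext rfl (Complex.nonneg_iff.mp hq0).2.symm⟩
  rw [ht] at hp0
  rw [hv] at hq0
  replace hp0 : 0 ≤ t := by exact_mod_cast hp0
  replace hq0 : 0 ≤ v := by exact_mod_cast hq0
  have hsum : t + v = 1 := by
    have h1 := φ.map_one
    have h2 : (1 : X × Y) = (1, 0) + (0, 1) := Prod.ext (by simp) (by simp)
    rw [h2, map_add, ht, hv] at h1
    exact_mod_cast h1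
  have hdec : ∀ c : X × Y, φ c = φ (c.1, 0) + φ (0, c.2) := by
    intro c
    rw [← map_add]
    simp
  -- A weight `0` is treated apart because `corner` divides by it; the state then lives on the other
  -- summand alone.
  rcases hp0.eq_or_lt with ht0 | ht0
  · have hzero : ∀ a : X, φ (a, (0 : Y)) = 0 := by
      intro a
      have := φ.apply_mul_eq_zero (u := ((1 : X), (0 : Y))) (by rw [hp, ht, ← ht0]; simp) (a, 0)
      simpa using this
    have hv1 : 0 < v := by linarith
    refine subset_convexHull ℝ _ ⟨φ, Or.inr ⟨φ.corner _ hr v hv1 hv, ?_⟩, rfl⟩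
    ext c
    change (v⁻¹ : ℝ) • φ ((0 : X), c.2) = φ c
    rw [hdec c, hzero, zero_add]
    have : v = 1 := by linarith
    simp [this]
  rcases hq0.eq_or_lt with hv0 | hv0
  · have hzero : ∀ b : Y, φ ((0 : X), b) = 0 := by
      intro b
      have := φ.apply_mul_eq_zero (u := ((0 : X), (1 : Y))) (by rw [hq, hv, ← hv0]; simp) (0, b)
      simpa using this
    refine subset_convexHull ℝ _ ⟨φ, Or.inl ⟨φ.corner _ hl t ht0 ht, ?_⟩, rfl⟩
    ext c
    change (t⁻¹ : ℝ) • φ (c.1, (0 : Y)) = φ c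
    rw [hdec c, hzero, add_zero]
    have : t = 1 := by linarith
    simp [this]
  · set φ₁ := φ.corner _ hl t ht0 ht
    set φ₂ := φ.corner _ hr v hv0 hv
    have hφ : φ.toDual = t • (φ₁.comap (StarAlgHom.fst ℂ X Y)).toDual
        + v • (φ₂.comap (StarAlgHom.snd ℂ X Y)).toDual := by
      refine DFunLike.ext _ _ fun c => ?_
      change φ c = t • (t⁻¹ : ℝ) • φ (c.1, (0 : Y)) + v • (v⁻¹ : ℝ) • φ ((0 : X), c.2)
      rw [smul_inv_smul₀ ht0.ne', smul_inv_smul₀ hv0.ne', hdec]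
    rw [hφ]
    refine convex_convexHull ℝ _ ?_ ?_ hp0 hq0 hsum
    · exact subset_convexHull ℝ _ (Set.mem_image_of_mem _ (Or.inl (Set.mem_range_self φ₁)))
    · exact subset_convexHull ℝ _ (Set.mem_image_of_mem _ (Or.inr (Set.mem_range_self φ₂)))

lemma Tunnel.depth_ofSum (L : selfAdjoint (X × Y) → ℝ≥0∞) (hL : IsLeibnizLipNorm L)
    (h₁ : IsQuotient (StarAlgHom.fst ℂ X Y) L X.L)
    (h₂ : IsQuotient (StarAlgHom.snd ℂ X Y) L Y.L) : (Tunnel.ofSum L hL h₁ h₂).depth = 0 := by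
  have h : {φ : StateSpace (X × Y) | φ.toDual ∈ closedConvexHull ℝ (StateSpace.toDual ''
      (Set.range (StateSpace.comap (StarAlgHom.fst ℂ X Y)) ∪
        Set.range (StateSpace.comap (StarAlgHom.snd ℂ X Y))))} = Set.univ :=
    Set.eq_univ_of_forall fun φ => convexHull_subset_closedConvexHull φ.mem_convexHull
  change mkHausdorff L Set.univ _ = 0
  rw [← h]
  exact @Metric.hausdorffEDist_self _ (mkEMetric L) _

lemma Tunnel.length_ofSum (L : selfAdjoint (X × Y) → ℝ≥0∞) (hL : IsLeibnizLipNorm L)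
    (h₁ : IsQuotient (StarAlgHom.fst ℂ X Y) L X.L)
    (h₂ : IsQuotient (StarAlgHom.snd ℂ X Y) L Y.L) :
    (Tunnel.ofSum L hL h₁ h₂).length = sumHausdorff X Y L := by
  rw [Tunnel.length, Tunnel.depth_ofSum]
  exact max_eq_left bot_le

end SumStates

/-! ## Bridges -/

section Bridges

variable {X Y : LQCMS.{u}}

namespace Bridge

/-- The linear map `(a, b) ↦ π_A(a) ω - ω π_B(b)`. -/
def diff (γ : Bridge X Y) : X × Y →ₗ[ℂ] γ.D where
  toFun c := γ.left c.1 * γ.pivot - γ.pivot * γ.right c.2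
  map_add' c d := by simp only [Prod.fst_add, Prod.snd_add, map_add, add_mul, mul_add]; abel
  map_smul' z c := by
    simp only [Prod.smul_fst, Prod.smul_snd, map_smul, smul_mul_assoc, mul_smul_comm, smul_sub,
      RingHom.id_apply]

lemma diff_apply (γ : Bridge X Y) (c : X × Y) :
    γ.diff c = γ.left c.1 * γ.pivot - γ.pivot * γ.right c.2 := rfl

/-- Insert the mixed term `π_A(c.1) ω π_B(d.2)`. This twisted derivation rule is the source of the
Leibniz inequalities for bridges. -/
lemma diff_mul (γ : Bridge X Y) (c d : X × Y) :
    γ.diff (c * d) = γ.left c.1 * γ.diff d + γ.diff c * γ.right d.2 := by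
  simp only [diff_apply, Prod.fst_mul, Prod.snd_mul, map_mul, mul_sub, sub_mul, mul_assoc]
  abel

lemma norm_diff_mul_le (γ : Bridge X Y) (c d : X × Y) :
    ‖γ.diff (c * d)‖ ≤ ‖c‖ * ‖γ.diff d‖ + ‖γ.diff c‖ * ‖d‖ := by
  rw [diff_mul]
  refine (norm_add_le _ _).trans (add_le_add ?_ ?_)
  · refine (norm_mul_le _ _).trans (mul_le_mul_of_nonneg_right ?_ (norm_nonneg _))
    exact (NonUnitalStarAlgHom.norm_apply_le γ.left c.1).trans (le_max_left _ _)
  · refine (norm_mul_le _ _).trans (mul_le_mul_of_nonneg_left ?_ (norm_nonneg _))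
    exact (NonUnitalStarAlgHom.norm_apply_le γ.right d.2).trans (le_max_right _ _)

/-- Serves the Jordan and the Lie product at once: their scalars `1 / 2` and `1 / (2i)` have the
same modulus, and `w` is `cd + dc` or `cd - dc`. -/
lemma norm_diff_smul_le (γ : Bridge X Y) {z : ℂ} (hz : ‖z‖ = 1 / 2) (c d w : X × Y)
    (hw : ‖γ.diff w‖ ≤ ‖γ.diff (c * d)‖ + ‖γ.diff (d * c)‖) :
    ‖γ.diff (z • w)‖ₑ ≤ ‖c‖ₑ * ‖γ.diff d‖ₑ + ‖d‖ₑ * ‖γ.diff c‖ₑ := by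
  simp only [← ofReal_norm]
  rw [← ENNReal.ofReal_mul (norm_nonneg _), ← ENNReal.ofReal_mul (norm_nonneg _),
    ← ENNReal.ofReal_add (by positivity) (by positivity)]
  refine ENNReal.ofReal_le_ofReal ?_
  rw [map_smul, norm_smul, hz]
  linarith [γ.norm_diff_mul_le c d, γ.norm_diff_mul_le d c]

/-- The seminorm `‖π_A(a) ω - ω π_B(b)‖ / r` on `A ⊕ B`. -/
def scaled (γ : Bridge X Y) (r : ℝ≥0) (c : selfAdjoint (X × Y)) : ℝ≥0∞ :=
  ‖γ.diff (c : X × Y)‖ₑ / r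

lemma sumNorm_eq (γ : Bridge X Y) (r : ℝ≥0) : γ.sumNorm r = sumSeminorm X Y (γ.scaled r) := rfl

lemma continuous_diff (γ : Bridge X Y) : Continuous γ.diff :=
  (((map_continuous γ.left).comp continuous_fst).mul continuous_const).sub
    (continuous_const.mul ((map_continuous γ.right).comp continuous_snd))

lemma pivot_ne_zero (γ : Bridge X Y) : γ.pivot ≠ 0 := by
  intro h
  obtain ⟨φ, hφ, -⟩ := γ.levelSet_nonempty
  rw [h, sub_zero, star_one, one_mul, φ.map_one] at hφ
  exact one_ne_zero hφ

lemma isSumBridge_scaled (γ : Bridge X Y) {r : ℝ≥0} (hr : r ≠ 0) : IsSumBridge (γ.scaled r) where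
  add_le c d := by
    rw [scaled, scaled, scaled, ← ENNReal.add_div, AddSubgroup.coe_add, map_add]
    exact ENNReal.div_le_div_right (enorm_add_le _ _) _
  smul t c := by
    rw [scaled, scaled, ← mul_div_assoc, selfAdjoint.val_smul, ← Complex.coe_smul, map_smul,
      enorm_smul]
    congr 2
    simp [← ofReal_norm]
  bound := by
    let f : X × Y →L[ℂ] γ.D := ⟨γ.diff, γ.continuous_diff⟩
    refine ⟨‖f‖₊ / r, fun c => ?_⟩
    rw [scaled, ENNReal.coe_div hr, mul_comm, ← mul_div_assoc, mul_comm]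
    exact ENNReal.div_le_div_right (f.le_opENorm _) _
  map_one := by
    rw [scaled, selfAdjoint.val_one, diff_apply]
    simp
  map_zero_one := by
    have h : γ.diff ((saPair 0 1 : selfAdjoint (X × Y)) : X × Y) = -γ.pivot := by
      simp [diff_apply, saPair]
    rw [scaled, h, enorm_neg]
    exact (ENNReal.div_pos (enorm_ne_zero.mpr γ.pivot_ne_zero) ENNReal.coe_ne_top).ne'

lemma isLeibnizLipNorm_sumNorm (γ : Bridge X Y) {r : ℝ≥0} (hr : r ≠ 0) :
    IsLeibnizLipNorm (γ.sumNorm r) := by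
  have hX := X.isLeibnizLipNorm
  have hY := Y.isLeibnizLipNorm
  have hfst : ∀ c : selfAdjoint (X × Y), ‖(saFst c : X)‖ₑ ≤ ‖(c : X × Y)‖ₑ := fun c =>
    enorm_le_iff_norm_le.mpr (le_max_left _ _)
  have hsnd : ∀ c : selfAdjoint (X × Y), ‖(saSnd c : Y)‖ₑ ≤ ‖(c : X × Y)‖ₑ := fun c =>
    enorm_le_iff_norm_le.mpr (le_max_right _ _)
  have key : ∀ c d e : selfAdjoint (X × Y),
      X.L (saFst e) ≤ ‖(saFst c : X)‖ₑ * X.L (saFst d) + ‖(saFst d : X)‖ₑ * X.L (saFst c) →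
      Y.L (saSnd e) ≤ ‖(saSnd c : Y)‖ₑ * Y.L (saSnd d) + ‖(saSnd d : Y)‖ₑ * Y.L (saSnd c) →
      ‖γ.diff (e : X × Y)‖ₑ ≤ ‖(c : X × Y)‖ₑ * ‖γ.diff (d : X × Y)‖ₑ
        + ‖(d : X × Y)‖ₑ * ‖γ.diff (c : X × Y)‖ₑ →
      γ.sumNorm r e ≤ ‖(c : X × Y)‖ₑ * γ.sumNorm r d + ‖(d : X × Y)‖ₑ * γ.sumNorm r c := by
    intro c d e h1 h2 h3
    have hc := (sumSeminorm_le_iff (N := γ.scaled r) (c := c)).mp le_rfl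
    have hd := (sumSeminorm_le_iff (N := γ.scaled r) (c := d)).mp le_rfl
    rw [sumNorm_eq]
    refine sumSeminorm_le_iff.mpr ⟨⟨h1.trans ?_, h2.trans ?_⟩, ?_⟩
    · exact add_le_add (mul_le_mul' (hfst c) hd.1.1) (mul_le_mul' (hfst d) hc.1.1)
    · exact add_le_add (mul_le_mul' (hsnd c) hd.1.2) (mul_le_mul' (hsnd d) hc.1.2)
    · refine (ENNReal.div_le_div_right h3 _).trans ?_
      rw [ENNReal.add_div, mul_div_assoc, mul_div_assoc]
      exact add_le_add (mul_le_mul' le_rfl hd.2) (mul_le_mul' le_rfl hc.2)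
  refine { (γ.isSumBridge_scaled hr).isLipNorm with
    jordan_le := fun c d => ?_
    lie_le := fun c d => ?_
    lowerSemicontinuous := ?_ }
  · refine key c d _ (hX.jordan_le (saFst c) (saFst d)) (hY.jordan_le (saSnd c) (saSnd d)) ?_
    refine γ.norm_diff_smul_le (by simp) _ _ _ ?_
    rw [map_add]
    exact norm_add_le _ _
  · refine key c d _ (hX.lie_le (saFst c) (saFst d)) (hY.lie_le (saSnd c) (saSnd d)) ?_
    refine γ.norm_diff_smul_le (by simp) _ _ _ ?_
    rw [map_sub]
    exact norm_sub_le _ _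
  · have h1 := hX.lowerSemicontinuous.comp (continuous_saFst (X := X) (Y := Y))
    have h2 := hY.lowerSemicontinuous.comp (continuous_saSnd (X := X) (Y := Y))
    have h3 : Continuous (γ.scaled r) :=
      (ENNReal.continuous_div_const _ (by simpa using hr)).comp
        (continuous_enorm.comp (γ.continuous_diff.comp continuous_subtype_val))
    exact (h1.sup h2).sup h3.lowerSemicontinuous

lemma ne_zero_of_length_lt {γ : Bridge X Y} {r : ℝ≥0} (h : γ.length < r) : r ≠ 0 := by
  rintro rfl
  simp at h

lemma enorm_diff_saPair_le (γ : Bridge X Y) {r s : ℝ≥0} {a : selfAdjoint X} {b : selfAdjoint Y}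
    (h : edist (γ.left (a : X) * γ.pivot) (γ.pivot * γ.right (b : Y)) < r) (hr : r ≠ 0) :
    γ.scaled r ((s : ℝ) • saPair a b) ≤ s := by
  have hd : γ.scaled r (saPair a b) ≤ 1 := by
    refine ENNReal.div_le_of_le_mul ?_
    rw [one_mul]
    refine le_trans (le_of_eq ?_) h.le
    rw [edist_eq_enorm_sub]
    rfl
  rw [(γ.isSumBridge_scaled hr).smul]
  refine (mul_le_mul_right hd _).trans (le_of_eq ?_)
  simp

/-- The reach only compares unit Lipschitz balls, so `a` is scaled by `s⁻¹`, matched there with some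
`b`, and scaled back. -/
lemma isQuotient_fst (γ : Bridge X Y) {r : ℝ≥0} (h : γ.length < r) :
    IsQuotient (StarAlgHom.fst ℂ X Y) (γ.sumNorm r) X.L := by
  refine isQuotient_fst_sumSeminorm fun a s ha => ?_
  have hs : s ≠ 0 := by
    rintro rfl
    simp at ha
  have hs' : (s : ℝ) ≠ 0 := NNReal.coe_ne_zero.mpr hs
  have ha1 := map_inv_smul_le_one X.isLeibnizLipNorm.smul hs ha.le
  have hmem : γ.left (((s : ℝ)⁻¹ • a : selfAdjoint X) : X) * γ.pivot ∈
      {d : γ.D | ∃ a : selfAdjoint X, X.L a ≤ 1 ∧ d = γ.left (a : X) * γ.pivot} := ⟨_, ha1, rfl⟩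
  have hreach : γ.reach < r := (le_max_left _ _).trans_lt h
  obtain ⟨_, ⟨b, hb, rfl⟩, hab⟩ := Metric.exists_edist_lt_of_hausdorffEDist_lt
    hmem hreach
  refine ⟨(s : ℝ) • b, ?_, ?_⟩
  · rw [Y.isLeibnizLipNorm.smul]
    exact (mul_le_mul_right hb _).trans (by simp)
  · have he : saPair a ((s : ℝ) • b) = (s : ℝ) • saPair ((s : ℝ)⁻¹ • a) b :=
      Subtype.ext (Prod.ext (smul_inv_smul₀ hs' (a : X)).symm rfl)
    have := γ.enorm_diff_saPair_le (s := s) hab (ne_zero_of_length_lt h)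
    rwa [← he] at this

lemma isQuotient_snd (γ : Bridge X Y) {r : ℝ≥0} (h : γ.length < r) :
    IsQuotient (StarAlgHom.snd ℂ X Y) (γ.sumNorm r) Y.L := by
  refine isQuotient_snd_sumSeminorm fun b s hb => ?_
  have hs : s ≠ 0 := by
    rintro rfl
    simp at hb
  have hs' : (s : ℝ) ≠ 0 := NNReal.coe_ne_zero.mpr hs
  have hb1 := map_inv_smul_le_one Y.isLeibnizLipNorm.smul hs hb.le
  have hmem : γ.pivot * γ.right (((s : ℝ)⁻¹ • b : selfAdjoint Y) : Y) ∈
      {d : γ.D | ∃ b : selfAdjoint Y, Y.L b ≤ 1 ∧ d = γ.pivot * γ.right (b : Y)} := ⟨_, hb1, rfl⟩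
  have hreach : γ.reach < r := (le_max_left _ _).trans_lt h
  rw [reach, Metric.hausdorffEDist_comm] at hreach
  obtain ⟨_, ⟨a, ha, rfl⟩, hab⟩ := Metric.exists_edist_lt_of_hausdorffEDist_lt
    hmem hreach
  rw [edist_comm] at hab
  refine ⟨(s : ℝ) • a, ?_, ?_⟩
  · rw [X.isLeibnizLipNorm.smul]
    exact (mul_le_mul_right ha _).trans (by simp)
  · have he : saPair ((s : ℝ) • a) b = (s : ℝ) • saPair a ((s : ℝ)⁻¹ • b) :=
      Subtype.ext (Prod.ext rfl (smul_inv_smul₀ hs' (b : Y)).symm)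
    have := γ.enorm_diff_saPair_le (s := s) hab (ne_zero_of_length_lt h)
    rwa [← he] at this

/-- A state in the level set of the pivot compares the two legs of the bridge. -/
lemma enorm_sub_le_of_mem_levelSet (γ : Bridge X Y) {r : ℝ≥0} (hr : r ≠ 0) {χ : StateSpace γ.D}
    (hχ : χ ∈ levelSet γ.pivot) {c : selfAdjoint (X × Y)} (hc : γ.sumNorm r c ≤ 1) :
    ‖χ.comap γ.left (saFst c : X) - χ.comap γ.right (saSnd c : Y)‖ₑ ≤ r := by
  -- Since `χ` annihilates multiples of `1 - ω`, left and right, `ω` may be inserted on the right of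
  -- `π_A(a)` and on the left of `π_B(b)`; the difference becomes `χ` of the bridge element.
  have h1 : χ (γ.left (saFst c : X) * (1 - γ.pivot)) = 0 := χ.apply_mul_eq_zero hχ.1 _
  have h2 : χ ((1 - γ.pivot) * γ.right (saSnd c : Y)) = 0 := χ.apply_mul_eq_zero' hχ.2 _
  rw [mul_sub, mul_one, map_sub, sub_eq_zero] at h1
  rw [sub_mul, one_mul, map_sub, sub_eq_zero] at h2
  have h3 : χ.comap γ.left (saFst c : X) - χ.comap γ.right (saSnd c : Y)
      = χ (γ.diff (c : X × Y)) := by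
    change χ (γ.left (saFst c : X)) - χ (γ.right (saSnd c : Y)) = _
    rw [h1, h2, ← map_sub]
    rfl
  rw [h3]
  refine (enorm_le_iff_norm_le.mpr (χ.norm_apply_le _)).trans ?_
  have h4 : γ.scaled r c ≤ 1 := ((sumSeminorm_le_iff (N := γ.scaled r)).mp hc).2
  rw [scaled, ENNReal.div_le_iff (by simpa using hr) ENNReal.coe_ne_top, one_mul] at h4
  exact h4

/-- One `r` pays for reaching the restriction of a state in the level set, the other for passing to
its restriction on the other side. -/
lemma sumHausdorff_sumNorm_le (γ : Bridge X Y) {r : ℝ≥0} (h : γ.length < r) :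
    sumHausdorff X Y (γ.sumNorm r) ≤ 2 * r := by
  have hr := ne_zero_of_length_lt h
  have hheight : γ.height < r := (le_max_right _ _).trans_lt h
  have hX := (le_max_left _ _).trans_lt hheight
  have hY := (le_max_right _ _).trans_lt hheight
  rw [two_mul]
  refine sumHausdorff_le (fun φ => ?_) fun ψ => ?_
  · obtain ⟨_, ⟨χ, hχ, rfl⟩, hd⟩ := @Metric.exists_edist_lt_of_hausdorffEDist_lt _
      (mkEMetric X.L) φ _ _ _ (Set.mem_univ φ) hX
    refine ⟨χ.comap γ.right, fun c hc => ?_⟩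
    rw [← sub_add_sub_cancel _ (χ.comap γ.left (saFst c : X))]
    refine (enorm_add_le _ _).trans (add_le_add ?_ (γ.enorm_sub_le_of_mem_levelSet hr hχ hc))
    exact (enorm_sub_le_mk ((sumSeminorm_le_iff (N := γ.scaled r)).mp hc).1.1 φ _).trans hd.le
  · obtain ⟨_, ⟨χ, hχ, rfl⟩, hd⟩ := @Metric.exists_edist_lt_of_hausdorffEDist_lt _
      (mkEMetric Y.L) ψ _ _ _ (Set.mem_univ ψ) hY
    refine ⟨χ.comap γ.left, fun c hc => ?_⟩
    rw [← sub_add_sub_cancel _ (χ.comap γ.right (saSnd c : Y))]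
    refine (enorm_add_le _ _).trans (add_le_add (γ.enorm_sub_le_of_mem_levelSet hr hχ hc) ?_)
    rw [← enorm_neg, neg_sub]
    exact (enorm_sub_le_mk ((sumSeminorm_le_iff (N := γ.scaled r)).mp hc).1.2 ψ _).trans hd.le

lemma exists_tunnel {C : Set LQCMS.{u}} {T : TunnelClass.{u}} (hT : ContainsBridgeTunnels C T)
    (hX : X ∈ C) (hY : Y ∈ C) (γ : Bridge X Y) {r : ℝ≥0} (h : γ.length < r) :
    ∃ τ ∈ T X Y, τ.length ≤ 2 * r :=
  ⟨_, hT X hX Y hY γ r h (γ.isLeibnizLipNorm_sumNorm (ne_zero_of_length_lt h))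
    (γ.isQuotient_fst h) (γ.isQuotient_snd h), by
      rw [Tunnel.length_ofSum]
      exact γ.sumHausdorff_sumNorm_le h⟩

end Bridge

lemma Trek.source_mem {C : Set LQCMS.{u}} (Γ : Trek C X Y) : X ∈ C := by
  cases Γ with
  | single hX hY γ => exact hX
  | cons hX γ Γ => exact hX

lemma Trek.exists_journey {C : Set LQCMS.{u}} {T : TunnelClass.{u}}
    (hT : ContainsBridgeTunnels C T) (Γ : Trek C X Y) :
    ∀ {r : ℝ≥0}, Γ.length < r → ∃ J : Journey C T X Y, J.length ≤ 2 * r := by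
  induction Γ with
  | single hX hY γ =>
    intro r hr
    obtain ⟨τ, hτ, hlen⟩ := γ.exists_tunnel hT hX hY hr
    exact ⟨.single hX hY τ hτ, hlen⟩
  | cons hX γ Γ ih =>
    intro r hr
    obtain ⟨p, q, hp, hq, rfl⟩ := exists_nnreal_add_eq_of_add_lt hr
    obtain ⟨τ, hτ, hlen⟩ := γ.exists_tunnel hT hX Γ.source_mem hp
    obtain ⟨J, hJ⟩ := ih hq
    refine ⟨.cons hX τ hτ J, ?_⟩
    rw [ENNReal.coe_add, mul_add]
    exact add_le_add hlen hJ

theorem dualPropinquityOn_le_two_mul_quantumPropinquityOn {C : Set LQCMS.{u}}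
    {T : TunnelClass.{u}} (hT : ContainsBridgeTunnels C T) (X Y : LQCMS.{u}) :
    dualPropinquityOn C T X Y ≤ 2 * quantumPropinquityOn C X Y := by
  rw [quantumPropinquityOn, ENNReal.mul_iInf_of_ne two_ne_zero ENNReal.ofNat_ne_top]
  refine le_iInf fun Γ => ?_
  -- Halving makes room for a real `r` strictly above the length of the trek, as the bridge
  -- seminorms require, with `2 * r` still below the dual propinquity.
  by_contra! hlt
  rw [mul_comm, ← ENNReal.lt_div_iff_mul_lt (Or.inl two_ne_zero)
    (Or.inl ENNReal.ofNat_ne_top)] at hlt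
  obtain ⟨r, hr1, hr2⟩ := ENNReal.lt_iff_exists_nnreal_btwn.mp hlt
  rw [ENNReal.lt_div_iff_mul_lt (Or.inl two_ne_zero) (Or.inl ENNReal.ofNat_ne_top),
    mul_comm] at hr2
  obtain ⟨J, hJ⟩ := Γ.exists_journey hT hr1
  exact absurd hr2 (not_lt.mpr ((iInf_le _ J).trans hJ))

end Bridges

/-! ## Comparison of classes of tunnels -/

section Classes

lemma Journey.exists_length_eq {C C' : Set LQCMS.{u}} {T G : TunnelClass.{u}} (hC : C ⊆ C')
    (hTG : ∀ X Y, T X Y ⊆ G X Y) {X Y : LQCMS.{u}} (J : Journey C T X Y) :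
    ∃ J' : Journey C' G X Y, J'.length = J.length := by
  induction J with
  | single hX hY τ hτ => exact ⟨.single (hC hX) (hC hY) τ (hTG _ _ hτ), rfl⟩
  | cons hX τ hτ J ih =>
    obtain ⟨J', hJ'⟩ := ih
    exact ⟨.cons (hC hX) τ (hTG _ _ hτ) J', congrArg (τ.length + ·) hJ'⟩

theorem dualPropinquityOn_mono {C C' : Set LQCMS.{u}} {T G : TunnelClass.{u}} (hC : C ⊆ C')
    (hTG : ∀ X Y, T X Y ⊆ G X Y) (X Y : LQCMS.{u}) :
    dualPropinquityOn C' G X Y ≤ dualPropinquityOn C T X Y := by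
  refine le_iInf fun J => ?_
  obtain ⟨J', hJ'⟩ := J.exists_length_eq hC hTG
  exact (iInf_le _ J').trans hJ'.le

/-- A competitor for `prox` is itself a tunnel in `CM`, and as its depth vanishes its length is
exactly the quantity minimized by `prox`. -/
theorem dualPropinquityCM_le_prox {X Y : LQCMS.{u}} (hX : X ∈ CM) (hY : Y ∈ CM) :
    dualPropinquityCM X Y ≤ prox X Y := by
  refine le_iInf₂ fun L hadm => le_iInf₂ fun hL hext => ?_
  rw [← Tunnel.length_ofSum L hL hadm.quotient_fst hadm.quotient_snd]
  exact iInf_le (fun J : Journey CM cmTunnels X Y => J.length)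
    (.single hX hY (Tunnel.ofSum L hL hadm.quotient_fst hadm.quotient_snd) ⟨hX, hY, hext⟩)

end Classes

end Propinquity

end

theorem mainTheorem4 :
    (∀ X Y : Propinquity.LQCMS.{u},
      Propinquity.distQ X Y ≤ Propinquity.dualPropinquity X Y ∧
      Propinquity.dualPropinquity X Y ≤ 2 * Propinquity.quantumPropinquity X Y) ∧
    (∀ (C : Set Propinquity.LQCMS.{u}) (T G : Propinquity.TunnelClass.{u}),
      Propinquity.IsCompatible C T → Propinquity.IsCompatible C G →
      (∀ X Y, T X Y ⊆ G X Y) → ∀ X ∈ C, ∀ Y ∈ C,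
        Propinquity.dualPropinquityOn C G X Y ≤ Propinquity.dualPropinquityOn C T X Y ∧
        (Propinquity.ContainsBridgeTunnels C T →
          Propinquity.dualPropinquityOn C T X Y ≤ 2 * Propinquity.quantumPropinquityOn C X Y)) ∧
    (∀ X ∈ Propinquity.CM.{u}, ∀ Y ∈ Propinquity.CM.{u},
      Propinquity.dualPropinquity X Y ≤ Propinquity.dualPropinquityCM X Y ∧
      Propinquity.dualPropinquityCM X Y ≤ Propinquity.prox X Y) := by
  refine ⟨fun X Y => ⟨?_, ?_⟩, fun C T G _ _ hTG X _ Y _ => ⟨?_, fun hT => ?_⟩,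
    fun X hX Y hY => ⟨?_, ?_⟩⟩
  · exact Propinquity.distQ_le_dualPropinquityOn _ _ X Y
  · exact Propinquity.dualPropinquityOn_le_two_mul_quantumPropinquityOn
      (fun _ _ _ _ _ _ _ _ _ _ => Set.mem_univ _) X Y
  · exact Propinquity.dualPropinquityOn_mono subset_rfl hTG X Y
  · exact Propinquity.dualPropinquityOn_le_two_mul_quantumPropinquityOn hT X Y
  · exact Propinquity.dualPropinquityOn_mono (Set.subset_univ _) (fun _ _ => Set.subset_univ _) X Y
  · exact Propinquity.dualPropinquityCM_le_prox hX hY
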